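/- \textbf{Discrete-time negative imaginary lemma.} Let $G(z)$ be an $m\times m$ matrix of real rational functions that is proper. Call $G$ \emph{discrete negative imaginary} (D-NI) if (i) $G$ is analytic in $\{z\in\mathbb{C}:|z|>1\}$; (ii) $i[G(z)-G(z)^*]\ge 0$ for all $z$ with $|z|>1$ and $\operatorname{Im} z>0$; (iii) $i[G(z)-G(z)^*]=0$ for all $z$ with $|z|>1$ and $\operatorname{Im} z=0$; (iv) $i[G(z)-G(z)^*]\le 0$ for all $z$ with $|z|>1$ and $\operatorname{Im} z<0$. Here $\ge 0$ and $>0$ denote positive semidefiniteness and positive definiteness of Hermitian matrices, and $M^*$ is the conjugate transpose of $M$. Let $(A,B,C,D)$ be a minimal realization of $G$: real matrices with $G(z)=C(zI-A)^{-1}B+D$ such that the size $n$ of $A$ is the smallest possible among all such realizations of $G$. Suppose $\det(I+A)\neq 0$ and $\det(I-A)\neq 0$, and consider the condition \[ (\ast)\qquad D=D^\top,\ \text{and there is a real matrix } X=X^\top>0 \text{ with } X-A^\top XA\ge 0 \text{ and } C=-B^\top(A^\top-I)^{-1}X(A+I). \] If $G$ is D-NI, then $(\ast)$ holds. If moreover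 $G$ is symmetric, i.e. $G(z)=G(z)^\top$, then $G$ is D-NI if and only if $(\ast)$ holds. -/

import Mathlib

open scoped ComplexOrder

noncomputable section

/-- The values of a matrix of real rational functions at a complex point. Each entry is evaluated in
lowest terms (with the value `0` at a pole, where the resulting function is then not analytic). -/
def transferEval {m : ℕ} (G : Matrix (Fin m) (Fin m) (RatFunc ℝ)) (z : ℂ) :
    Matrix (Fin m) (Fin m) ℂ :=
  G.map (RatFunc.eval (algebraMap ℝ ℂ) z)

/-- Properness: in every entry the degree of the numerator is at most that of the denominator. -/
def IsProperTransfer {m : ℕ} (G : Matrix (Fin m) (Fin m) (RatFunc ℝ)) : Prop :=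
  ∀ i j, (G i j).intDegree ≤ 0

/-- Discrete negative imaginary (D-NI) functions. -/
structure IsDiscreteNegImag {m : ℕ} (G : ℂ → Matrix (Fin m) (Fin m) ℂ) : Prop where
  analytic : ∀ i j, AnalyticOnNhd ℂ (fun z => G z i j) {z : ℂ | 1 < ‖z‖}
  upper : ∀ z : ℂ, 1 < ‖z‖ → 0 < z.im →
    (Complex.I • (G z - (G z).conjTranspose)).PosSemidef
  real_axis : ∀ z : ℂ, 1 < ‖z‖ → z.im = 0 →
    Complex.I • (G z - (G z).conjTranspose) = 0
  lower : ∀ z : ℂ, 1 < ‖z‖ → z.im < 0 →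
    (-(Complex.I • (G z - (G z).conjTranspose))).PosSemidef

/-- `(A, B, C, D)` is a state-space realization of `G`, that is, `G(z) = C (z I - A)⁻¹ B + D` as an
identity of matrices of rational functions. (`z I - A` is invertible over the field of rational
functions, its determinant being the characteristic polynomial of `A`.) -/
def IsRealization {m n : ℕ} (G : Matrix (Fin m) (Fin m) (RatFunc ℝ))
    (A : Matrix (Fin n) (Fin n) ℝ) (B : Matrix (Fin n) (Fin m) ℝ)
    (C : Matrix (Fin m) (Fin n) ℝ) (D : Matrix (Fin m) (Fin m) ℝ) : Prop :=
  G = C.map RatFunc.C *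
      ((RatFunc.X : RatFunc ℝ) • (1 : Matrix (Fin n) (Fin n) (RatFunc ℝ)) - A.map RatFunc.C)⁻¹ *
      B.map RatFunc.C + D.map RatFunc.C

/-- A realization is minimal if no realization of the same transfer function has a smaller state
dimension. -/
def IsMinimalRealization {m n : ℕ} (G : Matrix (Fin m) (Fin m) (RatFunc ℝ))
    (A : Matrix (Fin n) (Fin n) ℝ) (B : Matrix (Fin n) (Fin m) ℝ)
    (C : Matrix (Fin m) (Fin n) ℝ) (D : Matrix (Fin m) (Fin m) ℝ) : Prop :=
  IsRealization G A B C D ∧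
    ∀ (k : ℕ) (A' : Matrix (Fin k) (Fin k) ℝ) (B' : Matrix (Fin k) (Fin m) ℝ)
      (C' : Matrix (Fin m) (Fin k) ℝ) (D' : Matrix (Fin m) (Fin m) ℝ),
      IsRealization G A' B' C' D' → n ≤ k

/-- The state-space conditions of the discrete-time negative imaginary lemma: `D = Dᵀ` and there is
a real `X = Xᵀ > 0` with `X - Aᵀ X A ≥ 0` and `C = -Bᵀ (Aᵀ - I)⁻¹ X (A + I)`. -/
def NegImagStateSpaceCondition {m n : ℕ}
    (A : Matrix (Fin n) (Fin n) ℝ) (B : Matrix (Fin n) (Fin m) ℝ)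
    (C : Matrix (Fin m) (Fin n) ℝ) (D : Matrix (Fin m) (Fin m) ℝ) : Prop :=
  D = D.transpose ∧
    ∃ X : Matrix (Fin n) (Fin n) ℝ, X = X.transpose ∧ X.PosDef ∧
      (X - A.transpose * X * A).PosSemidef ∧
      C = -(B.transpose * (A.transpose - 1)⁻¹ * X * (A + 1))

end

/-! The link between the two conditions is H(z) = (z+1)/(z-1) · (G(1) - G(z)). On the unit circle
the factor (z+1)/(z-1) is purely imaginary, and G(1) is Hermitian, so negative imaginarity of G
becomes Re v*H(z)v ≥ 0. The resolvent identity gives H the realization (A, (1+A)N, C, CN) with N =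
(1-A)⁻¹B. Since A may have eigenvalues on the circle, the argument is run for (tA, tB) with t < 1,
that is for G on the circle of radius 1/t, and t → 1 is taken last.

Necessity. Minimality turns analyticity of G outside the disc into absence of eigenvalues of A there
(`IsMinimalRealization.det_resolvent_ne_zero`). A Parseval argument turns positive realness of H
into nonnegativity of the energy Σ u·y absorbed from rest over any finite horizon
(`suppliedEnergy_nonneg_of_positive_real`). The available storage, minus the infimum of the energy
over all horizons and inputs, is then finite by reachability and is a quadratic form xᵀYx
(`exists_storage`). Its dissipation inequality at x = -Nu + tw loses every term quadratic in u, so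
the coefficient of t must vanish: this is the formula for C, with X = 2Y. Observability makes Y
definite, and D is symmetric as the limit of Hermitian values of G along the real axis.

Sufficiency. The Lyapunov inequality keeps the spectrum of A in the closed disc. For symmetric G
only real test vectors v matter, and with (z-A)(a+ib) = Bv the quantity Im vᵀG(z)v equals vᵀCb. Its
sign follows from a Cayley transform to continuous time (`bilin_im_resolvent_nonpos`). -/

open Matrix Polynomial

universe u

/-! ### Minimal realizations: controllability and observability -/

section Realization

variable {m n k : ℕ} {G : Matrix (Fin m) (Fin m) (RatFunc ℝ)}
  {A : Matrix (Fin n) (Fin n) ℝ} {B : Matrix (Fin n) (Fin m) ℝ}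
  {C : Matrix (Fin m) (Fin n) ℝ} {D : Matrix (Fin m) (Fin m) ℝ}

theorem resolvent_ratFunc_eq (A : Matrix (Fin n) (Fin n) ℝ) :
    (RatFunc.X : RatFunc ℝ) • (1 : Matrix (Fin n) (Fin n) (RatFunc ℝ)) - A.map RatFunc.C =
      (algebraMap ℝ[X] (RatFunc ℝ)).mapMatrix A.charmatrix := by
  ext i j
  by_cases h : i = j
  · subst h; simp
  · simp [h]

theorem det_resolvent_ratFunc (A : Matrix (Fin n) (Fin n) ℝ) :
    ((RatFunc.X : RatFunc ℝ) • (1 : Matrix (Fin n) (Fin n) (RatFunc ℝ)) - A.map RatFunc.C).det =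
      algebraMap ℝ[X] (RatFunc ℝ) A.charpoly := by
  rw [resolvent_ratFunc_eq, ← RingHom.map_det]; rfl

theorem isUnit_det_resolvent_ratFunc (A : Matrix (Fin n) (Fin n) ℝ) :
    IsUnit ((RatFunc.X : RatFunc ℝ) • (1 : Matrix (Fin n) (Fin n) (RatFunc ℝ))
      - A.map RatFunc.C).det := by
  rw [det_resolvent_ratFunc, isUnit_iff_ne_zero]
  exact RatFunc.algebraMap_ne_zero A.charpoly_monic.ne_zero

/-- The intertwining passes to resolvents: (z-A)P = P(z-A') gives (z-A)⁻¹P = P(z-A')⁻¹. It serves to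
cut the state space down to an invariant subspace, P being the inclusion. -/
theorem IsRealization.of_intertwine (h : IsRealization G A B C D)
    {A' : Matrix (Fin k) (Fin k) ℝ} {B' : Matrix (Fin k) (Fin m) ℝ}
    {P : Matrix (Fin n) (Fin k) ℝ} (hA : A * P = P * A') (hB : B = P * B') :
    IsRealization G A' B' (C * P) D := by
  unfold IsRealization at *
  rw [h, hB]
  have hA2 : A.map RatFunc.C * P.map RatFunc.C = P.map RatFunc.C * A'.map RatFunc.C := by
    rw [← Matrix.map_mul, ← Matrix.map_mul, hA]
  set R := (RatFunc.X : RatFunc ℝ) • (1 : Matrix (Fin n) (Fin n) (RatFunc ℝ)) - A.map RatFunc.C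
    with hR
  set R' := (RatFunc.X : RatFunc ℝ) • (1 : Matrix (Fin k) (Fin k) (RatFunc ℝ)) - A'.map RatFunc.C
    with hR'
  have hRu : IsUnit R.det := isUnit_det_resolvent_ratFunc A
  have hRu' : IsUnit R'.det := isUnit_det_resolvent_ratFunc A'
  have key : R * P.map RatFunc.C = P.map RatFunc.C * R' := by
    rw [hR, hR', Matrix.sub_mul, Matrix.mul_sub, hA2]; simp
  have key2 : R⁻¹ * P.map RatFunc.C = P.map RatFunc.C * R'⁻¹ := by
    calc R⁻¹ * P.map RatFunc.C = R⁻¹ * (P.map RatFunc.C * R') * R'⁻¹ := by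
          rw [Matrix.mul_assoc, Matrix.mul_assoc, Matrix.mul_nonsing_inv _ hRu', Matrix.mul_one]
      _ = P.map RatFunc.C * R'⁻¹ := by
          rw [← key, ← Matrix.mul_assoc, Matrix.nonsing_inv_mul _ hRu, Matrix.one_mul]
  rw [Matrix.map_mul, Matrix.map_mul, ← Matrix.mul_assoc, Matrix.mul_assoc _ R⁻¹, key2]
  simp only [Matrix.mul_assoc]

theorem IsRealization.transpose (h : IsRealization G A B C D) :
    IsRealization Gᵀ Aᵀ Cᵀ Bᵀ Dᵀ := by
  unfold IsRealization at *
  rw [h]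
  simp only [Matrix.transpose_add, Matrix.transpose_mul, Matrix.transpose_nonsing_inv,
    Matrix.transpose_sub, Matrix.transpose_smul, Matrix.transpose_one, Matrix.transpose_map,
    Matrix.mul_assoc]

theorem IsMinimalRealization.transpose (h : IsMinimalRealization G A B C D) :
    IsMinimalRealization Gᵀ Aᵀ Cᵀ Bᵀ Dᵀ :=
  ⟨h.1.transpose, fun k A' B' C' D' h' => h.2 k A'ᵀ C'ᵀ B'ᵀ D'ᵀ (by simpa using h'.transpose)⟩

/-- A minimal realization is controllable. -/
theorem IsMinimalRealization.eq_top_of_invariant (h : IsMinimalRealization G A B C D)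
    (W : Submodule ℝ (Fin n → ℝ)) (hA : ∀ x ∈ W, A *ᵥ x ∈ W) (hB : ∀ u, B *ᵥ u ∈ W) : W = ⊤ := by
  by_contra hW
  have hlt : Module.finrank ℝ W < n := by
    simpa using Submodule.finrank_lt hW
  -- The columns of P are a basis of W; restricting A and B to W would give a realization of
  -- dimension below n.
  let b := Module.finBasis ℝ W
  let P : Matrix (Fin n) (Fin (Module.finrank ℝ W)) ℝ := Matrix.of fun i j => (b j : Fin n → ℝ) i
  have hP : ∀ x : W, P *ᵥ (b.repr x) = (x : Fin n → ℝ) := by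
    intro x
    have hx := congrArg (fun y : W => (y : Fin n → ℝ)) (b.sum_repr x)
    ext i
    rw [← congrFun hx i]
    simp only [Submodule.coe_sum, Finset.sum_apply, Submodule.coe_smul, Pi.smul_apply, smul_eq_mul,
      P, Matrix.mulVec, dotProduct, Matrix.of_apply, mul_comm]
  let A' : Matrix (Fin (Module.finrank ℝ W)) (Fin (Module.finrank ℝ W)) ℝ :=
    Matrix.of fun i j => b.repr ⟨A *ᵥ (b j : Fin n → ℝ), hA _ (b j).2⟩ i
  let B' : Matrix (Fin (Module.finrank ℝ W)) (Fin m) ℝ :=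
    Matrix.of fun i j => b.repr ⟨B *ᵥ Pi.single j 1, hB _⟩ i
  refine absurd (h.2 _ A' B' (C * P) D (h.1.of_intertwine ?_ ?_)) (not_le.mpr hlt)
  · ext i j
    have := congrFun (hP ⟨A *ᵥ (b j : Fin n → ℝ), hA _ (b j).2⟩) i
    exact this.symm
  · ext i j
    have := congrFun (hP ⟨B *ᵥ Pi.single j 1, hB _⟩) i
    have hcol : (B *ᵥ Pi.single j 1) i = B i j := by simp
    rw [← hcol]
    exact this.symm

/-- A minimal realization is observable. -/
theorem IsMinimalRealization.eq_zero_of_unobservable (h : IsMinimalRealization G A B C D)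
    {x : Fin n → ℝ} (hx : ∀ k : ℕ, C *ᵥ (A ^ k *ᵥ x) = 0) : x = 0 := by
  -- The annihilator of the orbit A^k x is invariant under Aᵀ and contains the range of Cᵀ, so
  -- controllability of the transposed realization applies to it.
  let W : Submodule ℝ (Fin n → ℝ) :=
    { carrier := {ξ | ∀ k : ℕ, ξ ⬝ᵥ (A ^ k *ᵥ x) = 0}
      add_mem' := fun {a b} ha hb k => by rw [add_dotProduct, ha k, hb k, add_zero]
      zero_mem' := fun k => zero_dotProduct _
      smul_mem' := fun c a ha k => by rw [smul_dotProduct, ha k, smul_zero] }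
  have hW : W = ⊤ := by
    refine h.transpose.eq_top_of_invariant W (fun ξ hξ k => ?_) (fun u k => ?_)
    · rw [Matrix.mulVec_transpose, ← Matrix.dotProduct_mulVec, Matrix.mulVec_mulVec, ← pow_succ']
      exact hξ (k + 1)
    · rw [Matrix.mulVec_transpose, ← Matrix.dotProduct_mulVec, hx k, dotProduct_zero]
  have : x ∈ W := hW ▸ Submodule.mem_top
  simpa using this 0

end Realization

/-- `RatFunc.eval` works in lowest terms, while state-space formulas carry the denominator
`charpoly`. The reduced denominator divides q, so it does not vanish at z either. -/
theorem RatFunc.eval_algebraMap_div {K L : Type u} [Field K] [Field L] (f : K →+* L) (z : L)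
    (p : K[X]) {q : K[X]} (hq : q.eval₂ f z ≠ 0) :
    RatFunc.eval f z (algebraMap K[X] (RatFunc K) p / algebraMap K[X] (RatFunc K) q) =
      p.eval₂ f z / q.eval₂ f z := by
  have hq0 : q ≠ 0 := by rintro rfl; simp at hq
  set x := algebraMap K[X] (RatFunc K) p / algebraMap K[X] (RatFunc K) q with hx
  have h1 : x.num * q = p * x.denom := (RatFunc.num_mul_eq_mul_denom_iff hq0).mpr hx
  have h2 : x.denom.eval₂ f z ≠ 0 := by
    obtain ⟨r, hr⟩ := RatFunc.denom_div_dvd p q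
    intro h0
    apply hq
    rw [hr, Polynomial.eval₂_mul, ← hx, h0, zero_mul]
  have h3 := congrArg (Polynomial.eval₂ f z) h1
  rw [Polynomial.eval₂_mul, Polynomial.eval₂_mul] at h3
  rw [RatFunc.eval, div_eq_div_iff h2 hq, h3]

/-! ### Evaluating a transfer function through its realization -/

section TransferEval

variable {m n : ℕ} {G : Matrix (Fin m) (Fin m) (RatFunc ℝ)}
  {A : Matrix (Fin n) (Fin n) ℝ} {B : Matrix (Fin n) (Fin m) ℝ}
  {C : Matrix (Fin m) (Fin n) ℝ} {D : Matrix (Fin m) (Fin m) ℝ}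

theorem eval₂_mapMatrix_charmatrix (A : Matrix (Fin n) (Fin n) ℝ) (z : ℂ) :
    (Polynomial.eval₂RingHom (algebraMap ℝ ℂ) z).mapMatrix A.charmatrix =
      z • (1 : Matrix (Fin n) (Fin n) ℂ) - A.map (algebraMap ℝ ℂ) := by
  ext i j
  by_cases h : i = j
  · subst h; simp
  · simp [h]

theorem eval₂_charpoly (A : Matrix (Fin n) (Fin n) ℝ) (z : ℂ) :
    A.charpoly.eval₂ (algebraMap ℝ ℂ) z =
      (z • (1 : Matrix (Fin n) (Fin n) ℂ) - A.map (algebraMap ℝ ℂ)).det := by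
  rw [← eval₂_mapMatrix_charmatrix, ← RingHom.map_det]; rfl

/-- The numerator, over the common denominator `A.charpoly`, of a state-space realization. -/
noncomputable def stateSpaceNum (A : Matrix (Fin n) (Fin n) ℝ) (B : Matrix (Fin n) (Fin m) ℝ)
    (C : Matrix (Fin m) (Fin n) ℝ) (D : Matrix (Fin m) (Fin m) ℝ) : Matrix (Fin m) (Fin m) ℝ[X] :=
  C.map Polynomial.C * A.charmatrix.adjugate * B.map Polynomial.C + A.charpoly • D.map Polynomial.C

theorem IsRealization.eq_div (h : IsRealization G A B C D) (i j : Fin m) :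
    G i j = algebraMap ℝ[X] (RatFunc ℝ) (stateSpaceNum A B C D i j) /
      algebraMap ℝ[X] (RatFunc ℝ) A.charpoly := by
  set ι := algebraMap ℝ[X] (RatFunc ℝ) with hι
  have hχ : ι A.charpoly ≠ 0 := RatFunc.algebraMap_ne_zero A.charpoly_monic.ne_zero
  have hmap : ∀ {p q : ℕ} (M : Matrix (Fin p) (Fin q) ℝ),
      M.map RatFunc.C = (M.map Polynomial.C).map ι := by
    intro p q M; ext i j; simp [hι]
  have hGN : G = (ι A.charpoly)⁻¹ • (stateSpaceNum A B C D).map ι := by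
    rw [h, resolvent_ratFunc_eq, Matrix.inv_def, ← RingHom.map_det, ← RingHom.map_adjugate,
      hmap, hmap B, hmap D]
    change _ = _ • ι.mapMatrix (stateSpaceNum A B C D)
    simp only [stateSpaceNum, map_add, Matrix.smul_mul, Matrix.mul_smul, Ring.inverse_eq_inv',
      smul_add]
    congr 1
    · congr 1
      simp [RingHom.mapMatrix_apply, Matrix.map_mul, hι]
    · ext i j
      simp only [RingHom.mapMatrix_apply, Matrix.map_apply, Matrix.smul_apply, smul_eq_mul,
        map_mul]
      field_simp
  conv_lhs => rw [hGN]
  simp [div_eq_inv_mul]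

theorem IsRealization.transferEval_eq (h : IsRealization G A B C D) {z : ℂ}
    (hz : (z • (1 : Matrix (Fin n) (Fin n) ℂ) - A.map (algebraMap ℝ ℂ)).det ≠ 0) :
    transferEval G z = C.map (algebraMap ℝ ℂ) *
      (z • (1 : Matrix (Fin n) (Fin n) ℂ) - A.map (algebraMap ℝ ℂ))⁻¹ * B.map (algebraMap ℝ ℂ) +
      D.map (algebraMap ℝ ℂ) := by
  set φ := Polynomial.eval₂RingHom (algebraMap ℝ ℂ) z with hφ
  have hdet : A.charpoly.eval₂ (algebraMap ℝ ℂ) z ≠ 0 := by rwa [eval₂_charpoly]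
  have hE : transferEval G z = (A.charpoly.eval₂ (algebraMap ℝ ℂ) z)⁻¹ • (stateSpaceNum A B C D).map φ := by
    ext i j
    simp only [transferEval, Matrix.map_apply, Matrix.smul_apply, smul_eq_mul]
    rw [h.eq_div, RatFunc.eval_algebraMap_div _ _ _ hdet, div_eq_inv_mul]
    rfl
  have hmap : ∀ {p q : ℕ} (M : Matrix (Fin p) (Fin q) ℝ),
      M.map (algebraMap ℝ ℂ) = (M.map Polynomial.C).map φ := by
    intro p q M; ext i j; simp [hφ]
  rw [hE, Matrix.inv_def, ← eval₂_mapMatrix_charmatrix, ← RingHom.map_adjugate,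
    ← RingHom.map_det, hmap C, hmap B, hmap D]
  change _ • φ.mapMatrix (stateSpaceNum A B C D) = _
  have hd : φ A.charmatrix.det = A.charpoly.eval₂ (algebraMap ℝ ℂ) z := rfl
  rw [← hφ, hd]
  simp only [stateSpaceNum, map_add, Matrix.smul_mul, Matrix.mul_smul, Ring.inverse_eq_inv', smul_add]
  congr 1
  · congr 1
    simp [RingHom.mapMatrix_apply, Matrix.map_mul]
  · ext i j
    have hd' : φ A.charpoly ≠ 0 := hdet
    simp only [RingHom.mapMatrix_apply, Matrix.map_apply, Matrix.smul_apply, smul_eq_mul,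
      map_mul]
    rw [← hd, ← Matrix.charpoly]
    field_simp

theorem IsRealization.analyticAt_transferEval (h : IsRealization G A B C D) {z : ℂ}
    (hz : (z • (1 : Matrix (Fin n) (Fin n) ℂ) - A.map (algebraMap ℝ ℂ)).det ≠ 0) (i j : Fin m) :
    AnalyticAt ℂ (fun z => transferEval G z i j) z := by
  have hden : (G i j).denom.eval₂ (algebraMap ℝ ℂ) z ≠ 0 := by
    intro h0
    obtain ⟨r, hr⟩ := RatFunc.denom_div_dvd (stateSpaceNum A B C D i j) A.charpoly
    rw [← h.eq_div] at hr
    apply hz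
    rw [← eval₂_charpoly, hr, Polynomial.eval₂_mul, h0, zero_mul]
  have hpoly : ∀ p : ℝ[X], AnalyticAt ℂ (fun z => p.eval₂ (algebraMap ℝ ℂ) z) z := fun p => by
    simpa [Polynomial.aeval_def] using AnalyticAt.aeval_polynomial (analyticAt_id (z := z)) p
  exact (hpoly _).div (hpoly _) hden

end TransferEval

/-! ### Dissipativity inequalities for bilinear forms -/

section Forms

variable {E : Type*} [AddCommGroup E] [Module ℝ E] (β : LinearMap.BilinForm ℝ E)

/-- In complex notation (σ+iω)(p+iq) - (P+iQ) = c with c real. Expanding, ωβ(c,Q) = σβ(Q,Q) -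
(σ²+ω²)β(q,Q) - ωβ(P,Q). Dissipativity at (0,1) gives β(q,Q) ≤ 0; at (ω,σ), where ωp + σq = Q, it
gives -ωβ(P,Q) ≥ σβ(Q,Q). -/
theorem bilin_nonneg_of_dissipative (hβ : ∀ x y, β x y = β y x) (hpos : ∀ x, 0 ≤ β x x)
    {σ ω : ℝ} (hσ : 0 ≤ σ) (hω : 0 < ω) {p q P Q c : E}
    (hdis : ∀ s t : ℝ, β (s • p + t • q) (s • P + t • Q) ≤ 0)
    (hQ : Q = σ • q + ω • p) (hc : c = σ • p - ω • q - P) : 0 ≤ β c Q := by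
  have h1 := hdis ω σ
  have h2 := hdis 0 1
  have h3 := mul_nonneg hσ (hpos Q)
  have hQP : β P Q = σ * β q P + ω * β p P := by
    rw [hQ]; simp [hβ P]
  have hQQ : β Q Q = σ * β q Q + ω * β p Q := by
    calc β Q Q = β (σ • q + ω • p) Q := by rw [← hQ]
      _ = _ := by simp
  simp only [map_add, map_smul, LinearMap.add_apply, LinearMap.smul_apply, smul_eq_mul, zero_smul,
    one_smul, zero_add] at h1 h2
  have h4 : β c Q = σ * β p Q - ω * β q Q - β P Q := by rw [hc]; simp
  have h5 : 0 ≤ ω * β c Q := by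
    rw [h4, hQP]
    nlinarith [mul_nonneg (add_nonneg (sq_nonneg σ) (sq_nonneg ω)) (neg_nonneg.mpr h2)]
  exact nonneg_of_mul_nonneg_right h5 hω

/-- A Cayley transform reduces this to the previous lemma: for a contraction A, β((A+1)g, (A-1)g) =
β(Ag,Ag) - β(g,g) ≤ 0, and the frequency z = x+iy becomes σ+iω = (z-1)/(z+1), with σ ≥ 0 because |z|
≥ 1. -/
theorem bilin_im_resolvent_nonpos (hβ : ∀ x y, β x y = β y x) (hpos : ∀ x, 0 ≤ β x x)
    {A : E →ₗ[ℝ] E} (hA : ∀ x, β (A x) (A x) ≤ β x x) {x y : ℝ} (hy : 0 < y)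
    (hxy : 1 ≤ x ^ 2 + y ^ 2) {a b c : E} (ha : A a = x • a - y • b - c)
    (hb : A b = x • b + y • a) : β c (b - A (A b)) ≤ 0 := by
  -- With g = e+if = (z+1)(a+ib) and ρ = |z+1|², the equations for a and b become (σ+iω)(A+1)g -
  -- (A-1)g = 2c.
  set e := (x + 1) • a - y • b with he
  set f := (x + 1) • b + y • a with hf
  have hρ : 0 < (x + 1) ^ 2 + y ^ 2 := by positivity
  set ρ := (x + 1) ^ 2 + y ^ 2 with hρd
  have hAe : A e = (x + 1) • (x • a - y • b - c) - y • (x • b + y • a) := by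
    rw [he, map_sub, map_smul, map_smul, ha, hb]
  have hAf : A f = (x + 1) • (x • b + y • a) + y • (x • a - y • b - c) := by
    rw [hf, map_add, map_smul, map_smul, ha, hb]
  have key := bilin_nonneg_of_dissipative β hβ hpos (σ := ρ⁻¹ * (x ^ 2 + y ^ 2 - 1))
    (ω := ρ⁻¹ * (2 * y)) (p := e + A e) (q := f + A f) (P := A e - e) (Q := A f - f)
    (c := (2 : ℝ) • c) (mul_nonneg (inv_nonneg.mpr hρ.le) (by linarith)) (by positivity) ?_ ?_ ?_
  · have h1 : b - A (A b) = -(A f - f) := by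
      have : f = b + A b := by rw [hb, hf]; module
      rw [this, map_add]; abel
    rw [h1, map_neg]
    simp only [map_smul, LinearMap.smul_apply, smul_eq_mul] at key
    linarith
  · intro s t
    have h1 : s • (e + A e) + t • (f + A f) = (s • e + t • f) + A (s • e + t • f) := by
      simp only [map_add, map_smul]; module
    have h2 : s • (A e - e) + t • (A f - f) = A (s • e + t • f) - (s • e + t • f) := by
      simp only [map_add, map_smul]; module
    rw [h1, h2]
    have h3 := hA (s • e + t • f)
    have h4 := hβ (s • e + t • f) (A (s • e + t • f))
    simp only [map_add β, map_sub, LinearMap.add_apply] at h3 h4 ⊢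
    linarith
  · rw [mul_smul, mul_smul, ← smul_add, eq_inv_smul_iff₀ hρ.ne', hAe, hAf, he, hf, hρd]
    module
  · have h0 : (2 : ℝ) • c + (A e - e) = ρ⁻¹ • ((x ^ 2 + y ^ 2 - 1) • (e + A e)
        - (2 * y) • (f + A f)) := by
      rw [eq_inv_smul_iff₀ hρ.ne', hAe, hAf, he, hf, hρd]
      module
    rw [mul_smul, mul_smul, ← smul_sub, ← h0]; abel

end Forms

/-! ### Real matrices acting on complex vectors -/

section Complexification

variable {ι κ : Type*} [Fintype κ]

theorem re_map_mulVec (M : Matrix ι κ ℝ) (q : κ → ℂ) (i : ι) :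
    ((M.map (algebraMap ℝ ℂ) *ᵥ q) i).re = (M *ᵥ fun j => (q j).re) i := by
  simp [Matrix.mulVec, dotProduct]

theorem im_map_mulVec (M : Matrix ι κ ℝ) (q : κ → ℂ) (i : ι) :
    ((M.map (algebraMap ℝ ℂ) *ᵥ q) i).im = (M *ᵥ fun j => (q j).im) i := by
  simp [Matrix.mulVec, dotProduct]

theorem map_mulVec_ofReal (M : Matrix ι κ ℝ) (q : κ → ℝ) :
    M.map (algebraMap ℝ ℂ) *ᵥ (fun j => (q j : ℂ)) = fun i => ((M *ᵥ q) i : ℂ) := by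
  ext i
  simp [Matrix.mulVec, dotProduct]

theorem Matrix.PosSemidef.map_algebraMap_complex {κ : Type*} [Fintype κ] {M : Matrix κ κ ℝ}
    (hM : M.PosSemidef) : (M.map (algebraMap ℝ ℂ)).PosSemidef := by
  have hs : Mᵀ = M := by simpa using hM.isHermitian.eq
  refine Matrix.PosSemidef.of_dotProduct_mulVec_nonneg ?_ fun q => ?_
  · ext i j
    simpa using congrArg (fun x : ℝ => (x : ℂ)) (congrFun (congrFun hs i) j)
  · have h1 := hM.dotProduct_mulVec_nonneg fun i => (q i).re
    have h2 := hM.dotProduct_mulVec_nonneg fun i => (q i).im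
    have h3 : (fun i => (q i).re) ⬝ᵥ (M *ᵥ fun i => (q i).im) =
        (fun i => (q i).im) ⬝ᵥ (M *ᵥ fun i => (q i).re) := by
      rw [Matrix.dotProduct_mulVec, dotProduct_comm, ← Matrix.mulVec_transpose, hs]
    rw [star_trivial] at h1 h2
    rw [Complex.nonneg_iff]
    constructor
    · refine (add_nonneg h1 h2).trans_eq ?_
      simp only [dotProduct, Complex.re_sum, Pi.star_apply, Complex.mul_re, re_map_mulVec,
        im_map_mulVec, ← Finset.sum_add_distrib]
      refine Finset.sum_congr rfl fun i _ => ?_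
      simp
    · refine (sub_eq_zero.mpr h3).symm.trans ?_
      simp only [dotProduct, Complex.im_sum, Pi.star_apply, Complex.mul_im, re_map_mulVec,
        im_map_mulVec, ← Finset.sum_sub_distrib]
      refine Finset.sum_congr rfl fun i _ => ?_
      simp
      ring

/-- Real and imaginary parts of the equation `(z - A) q = b` with `b` real. -/
theorem re_im_of_resolvent_eq {A : Matrix κ κ ℝ} [DecidableEq κ] {z : ℂ} {q : κ → ℂ} {b : κ → ℝ}
    (h : (z • (1 : Matrix κ κ ℂ) - A.map (algebraMap ℝ ℂ)) *ᵥ q = fun i => (b i : ℂ)) :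
    (A *ᵥ fun i => (q i).re) =
        (z.re • fun i => (q i).re) - (z.im • fun i => (q i).im) - b ∧
      (A *ᵥ fun i => (q i).im) = (z.re • fun i => (q i).im) + (z.im • fun i => (q i).re) := by
  rw [Matrix.sub_mulVec, Matrix.smul_mulVec, Matrix.one_mulVec] at h
  constructor
  · ext i
    have := congrArg Complex.re (congrFun h i)
    simp only [Pi.sub_apply, Complex.sub_re, re_map_mulVec, Pi.smul_apply, smul_eq_mul,
      Complex.mul_re, Complex.ofReal_re] at this ⊢
    linarith
  · ext i
    have := congrArg Complex.im (congrFun h i)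
    simp only [Pi.sub_apply, Complex.sub_im, im_map_mulVec, Pi.smul_apply, smul_eq_mul,
      Complex.mul_im, Complex.ofReal_im, Pi.add_apply] at this ⊢
    linarith

end Complexification

/-! ### Stability from the Lyapunov inequality -/

section Lyapunov

variable {m n : ℕ} {A X : Matrix (Fin n) (Fin n) ℝ}

theorem Matrix.PosSemidef.lyapunov_le (hL : (X - Aᵀ * X * A).PosSemidef) (x : Fin n → ℝ) :
    (A *ᵥ x) ⬝ᵥ (X *ᵥ (A *ᵥ x)) ≤ x ⬝ᵥ (X *ᵥ x) := by
  have := hL.dotProduct_mulVec_nonneg x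
  rw [star_trivial, Matrix.sub_mulVec, dotProduct_sub, Matrix.mul_assoc, ← Matrix.mulVec_mulVec,
    ← Matrix.mulVec_mulVec, Matrix.dotProduct_mulVec x Aᵀ, Matrix.vecMul_transpose] at this
  linarith

theorem dotProduct_mulVec_comm_of_symm (hX : X = Xᵀ) (x y : Fin n → ℝ) :
    x ⬝ᵥ (X *ᵥ y) = y ⬝ᵥ (X *ᵥ x) := by
  rw [Matrix.dotProduct_mulVec, dotProduct_comm, ← Matrix.mulVec_transpose, ← hX]

/-- An eigenvector a+ib for z would give |z|²(aᵀXa + bᵀXb) ≤ aᵀXa + bᵀXb, hence a = b = 0 by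
definiteness of X. -/
theorem det_resolvent_ne_zero_of_lyapunov (hX : X.PosDef) (hL : (X - Aᵀ * X * A).PosSemidef)
    {z : ℂ} (hz : 1 < ‖z‖) :
    (z • (1 : Matrix (Fin n) (Fin n) ℂ) - A.map (algebraMap ℝ ℂ)).det ≠ 0 := by
  intro h0
  obtain ⟨q, hq0, hq⟩ := Matrix.exists_mulVec_eq_zero_iff.mpr h0
  obtain ⟨ha, hb⟩ := re_im_of_resolvent_eq (b := 0) (q := q) (by rw [hq]; ext; simp)
  rw [sub_zero] at ha
  have hsq : 1 < z.re ^ 2 + z.im ^ 2 := by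
    have : ‖z‖ ^ 2 = z.re ^ 2 + z.im ^ 2 := by
      rw [← Complex.normSq_eq_norm_sq, Complex.normSq_apply]; ring
    rw [← this]; nlinarith
  have hXs : X = Xᵀ := by simpa using hX.isHermitian.eq.symm
  set a : Fin n → ℝ := fun i => (q i).re
  set b : Fin n → ℝ := fun i => (q i).im
  have h1 := hL.lyapunov_le a
  have h2 := hL.lyapunov_le b
  have h3 := dotProduct_mulVec_comm_of_symm hXs a b
  rw [ha] at h1
  rw [hb] at h2
  simp only [Matrix.mulVec_sub, Matrix.mulVec_add, Matrix.mulVec_smul, dotProduct_sub,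
    sub_dotProduct, dotProduct_add, add_dotProduct, dotProduct_smul, smul_dotProduct,
    smul_eq_mul] at h1 h2
  have pa : 0 ≤ a ⬝ᵥ (X *ᵥ a) := by simpa using hX.posSemidef.dotProduct_mulVec_nonneg a
  have pb : 0 ≤ b ⬝ᵥ (X *ᵥ b) := by simpa using hX.posSemidef.dotProduct_mulVec_nonneg b
  have hsum : (z.re ^ 2 + z.im ^ 2 - 1) * (a ⬝ᵥ (X *ᵥ a) + b ⬝ᵥ (X *ᵥ b)) ≤ 0 := by
    nlinarith
  have hsum0 : a ⬝ᵥ (X *ᵥ a) + b ⬝ᵥ (X *ᵥ b) ≤ 0 := by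
    by_contra hcon
    push Not at hcon
    nlinarith
  have hzero : ∀ x : Fin n → ℝ, x ⬝ᵥ (X *ᵥ x) = 0 → x = 0 := by
    intro x hx
    by_contra hx0
    have := hX.dotProduct_mulVec_pos hx0
    rw [star_trivial, hx] at this
    exact lt_irrefl _ this
  have ha0 : a = 0 := hzero a (by linarith)
  have hb0 : b = 0 := hzero b (by linarith)
  apply hq0
  ext i
  exact Complex.ext (congrFun ha0 i) (congrFun hb0 i)

end Lyapunov

/-! ### Sufficiency for symmetric transfer functions -/

section Sufficiency

variable {m n : ℕ} {G : Matrix (Fin m) (Fin m) (RatFunc ℝ)}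
  {A X : Matrix (Fin n) (Fin n) ℝ} {B : Matrix (Fin n) (Fin m) ℝ}
  {C : Matrix (Fin m) (Fin n) ℝ} {D : Matrix (Fin m) (Fin m) ℝ}

/-- Here a+ib = (z-A)⁻¹Bv; since C, D and v are real, only b reaches the imaginary part. -/
theorem IsRealization.exists_im_transferEval (h : IsRealization G A B C D) {z : ℂ}
    (hz : (z • (1 : Matrix (Fin n) (Fin n) ℂ) - A.map (algebraMap ℝ ℂ)).det ≠ 0)
    (v : Fin m → ℝ) :
    ∃ a b : Fin n → ℝ, A *ᵥ a = z.re • a - z.im • b - B *ᵥ v ∧ A *ᵥ b = z.re • b + z.im • a ∧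
      (transferEval G z).map Complex.im *ᵥ v = C *ᵥ b := by
  set R := z • (1 : Matrix (Fin n) (Fin n) ℂ) - A.map (algebraMap ℝ ℂ) with hR
  let q : Fin n → ℂ := R⁻¹ *ᵥ fun i => ((B *ᵥ v) i : ℂ)
  obtain ⟨h1, h2⟩ := re_im_of_resolvent_eq (A := A) (z := z) (q := q) (b := B *ᵥ v) (by
    rw [← hR]
    simp only [q]
    rw [Matrix.mulVec_mulVec, Matrix.mul_nonsing_inv _ (isUnit_iff_ne_zero.mpr hz),
      Matrix.one_mulVec])
  refine ⟨_, _, h1, h2, ?_⟩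
  have h3 : transferEval G z *ᵥ (fun i => (v i : ℂ)) = C.map (algebraMap ℝ ℂ) *ᵥ q +
      fun i => ((D *ᵥ v) i : ℂ) := by
    rw [h.transferEval_eq hz, Matrix.add_mulVec, ← Matrix.mulVec_mulVec, ← Matrix.mulVec_mulVec,
      map_mulVec_ofReal, map_mulVec_ofReal]
  ext i
  have h4 := congrArg Complex.im (congrFun h3 i)
  rw [Pi.add_apply, Complex.add_im, im_map_mulVec, Complex.ofReal_im, add_zero] at h4
  rw [← h4]
  simp [Matrix.mulVec, dotProduct]

theorem mul_one_sub_inv_comm (hminus : (1 - A).det ≠ 0) : A * (1 - A)⁻¹ = (1 - A)⁻¹ * A := by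
  have hu : IsUnit (1 - A).det := isUnit_iff_ne_zero.mpr hminus
  have hRl := Matrix.nonsing_inv_mul _ hu
  have hRr := Matrix.mul_nonsing_inv _ hu
  rw [Matrix.sub_mul, Matrix.one_mul, sub_eq_iff_eq_add] at hRr
  rw [Matrix.mul_sub, Matrix.mul_one, sub_eq_iff_eq_add] at hRl
  exact add_left_cancel (hRr.symm.trans hRl)

theorem neg_transpose_mul_inv_mul (hminus : (1 - A).det ≠ 0) :
    -(Bᵀ * (Aᵀ - 1)⁻¹ * X * (A + 1)) = ((1 - A)⁻¹ * B)ᵀ * X * (A + 1) := by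
  have h1 : (Aᵀ - 1)⁻¹ = -((1 - A)⁻¹)ᵀ := by
    rw [Matrix.transpose_nonsing_inv, Matrix.transpose_sub, Matrix.transpose_one, ← neg_sub 1 Aᵀ]
    apply Matrix.inv_eq_left_inv
    rw [neg_mul_neg]
    apply Matrix.nonsing_inv_mul
    rwa [← Matrix.transpose_one, ← Matrix.transpose_sub, Matrix.det_transpose,
      isUnit_iff_ne_zero]
  rw [h1, Matrix.transpose_mul]
  simp

/-- Applying R = (1-A)⁻¹, which commutes with A, to the resolvent equation turns vᵀCb into
cᵀX(1-A²)Rb with c = RBv, the quantity bounded by `bilin_im_resolvent_nonpos`. -/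
theorem im_transferEval_nonpos (h : IsRealization G A B C D) (hminus : (1 - A).det ≠ 0)
    (hXs : X = Xᵀ) (hX : X.PosDef) (hL : (X - Aᵀ * X * A).PosSemidef)
    (hC : C = -(Bᵀ * (Aᵀ - 1)⁻¹ * X * (A + 1))) {z : ℂ} (hz : 1 < ‖z‖) (v : Fin m → ℝ) :
    z.im * (v ⬝ᵥ ((transferEval G z).map Complex.im *ᵥ v)) ≤ 0 := by
  obtain ⟨a, b, ha, hb, hab⟩ :=
    h.exists_im_transferEval (det_resolvent_ne_zero_of_lyapunov hX hL hz) v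
  rw [hab]
  have hsq : 1 < z.re ^ 2 + z.im ^ 2 := by
    have : ‖z‖ ^ 2 = z.re ^ 2 + z.im ^ 2 := by
      rw [← Complex.normSq_eq_norm_sq, Complex.normSq_apply]; ring
    rw [← this]; nlinarith
  have hu : IsUnit (1 - A).det := isUnit_iff_ne_zero.mpr hminus
  set R := (1 - A)⁻¹ with hR
  have hRr : (1 - A) * R = 1 := Matrix.mul_nonsing_inv _ hu
  have hcomm : A * R = R * A := mul_one_sub_inv_comm hminus
  have hCt : C = (R * B)ᵀ * X * (A + 1) := by rw [hC, neg_transpose_mul_inv_mul hminus]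
  have hmap : ∀ x, A *ᵥ (R *ᵥ x) = R *ᵥ (A *ᵥ x) := fun x => by
    rw [Matrix.mulVec_mulVec, Matrix.mulVec_mulVec, hcomm]
  have ha' : A *ᵥ (R *ᵥ a) = z.re • (R *ᵥ a) - z.im • (R *ᵥ b) - R *ᵥ (B *ᵥ v) := by
    rw [hmap, ha]; simp only [Matrix.mulVec_sub, Matrix.mulVec_smul]
  have hb' : A *ᵥ (R *ᵥ b) = z.re • (R *ᵥ b) + z.im • (R *ᵥ a) := by
    rw [hmap, hb]; simp only [Matrix.mulVec_add, Matrix.mulVec_smul]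
  have hval : v ⬝ᵥ (C *ᵥ b) = (R *ᵥ (B *ᵥ v)) ⬝ᵥ
      (X *ᵥ ((R *ᵥ b) - A *ᵥ (A *ᵥ (R *ᵥ b)))) := by
    have h1 : b = (R *ᵥ b) - A *ᵥ (R *ᵥ b) := by
      conv_lhs => rw [← Matrix.one_mulVec b, ← hRr, ← Matrix.mulVec_mulVec, Matrix.sub_mulVec,
        Matrix.one_mulVec]
    have h2 : (A + 1) *ᵥ b = (R *ᵥ b) - A *ᵥ (A *ᵥ (R *ᵥ b)) := by
      rw [Matrix.add_mulVec, Matrix.one_mulVec]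
      conv_lhs => rw [h1]
      rw [Matrix.mulVec_sub]; abel
    rw [← h2, hCt, ← Matrix.mulVec_mulVec, ← Matrix.mulVec_mulVec, Matrix.dotProduct_mulVec,
      Matrix.vecMul_transpose, Matrix.mulVec_mulVec v]
  have hsym : ∀ x y, Matrix.toBilin' X x y = Matrix.toBilin' X y x := fun x y => by
    simpa [Matrix.toBilin'_apply'] using dotProduct_mulVec_comm_of_symm hXs x y
  have hpos : ∀ x, 0 ≤ Matrix.toBilin' X x x := fun x => by
    simpa [Matrix.toBilin'_apply'] using hX.posSemidef.dotProduct_mulVec_nonneg x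
  have hcon : ∀ x, Matrix.toBilin' X (A.mulVecLin x) (A.mulVecLin x) ≤ Matrix.toBilin' X x x :=
    fun x => by simpa [Matrix.toBilin'_apply'] using hL.lyapunov_le x
  rw [hval]
  rcases lt_trichotomy z.im 0 with hneg | h0 | hpos'
  -- Conjugating z replaces b by -b, which moves the problem to the upper half-plane.
  · have := bilin_im_resolvent_nonpos (Matrix.toBilin' X) hsym hpos hcon (x := z.re) (y := -z.im)
      (a := R *ᵥ a) (b := -(R *ᵥ b)) (c := R *ᵥ (B *ᵥ v)) (by linarith) (by nlinarith)
      (by simp [ha']) (by simp [Matrix.mulVec_neg, hb']; abel)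
    simp only [Matrix.toBilin'_apply', Matrix.mulVecLin_apply, Matrix.mulVec_neg, ← neg_sub',
      dotProduct_neg] at this
    nlinarith
  · simp [h0]
  · have := bilin_im_resolvent_nonpos (Matrix.toBilin' X) hsym hpos hcon hpos' hsq.le ha' hb'
    simp only [Matrix.toBilin'_apply', Matrix.mulVecLin_apply] at this
    nlinarith

theorem im_transferEval_eq_zero (h : IsRealization G A B C D) (hX : X.PosDef)
    (hL : (X - Aᵀ * X * A).PosSemidef) {z : ℂ} (hz : 1 < ‖z‖) (him : z.im = 0) :
    (transferEval G z).map Complex.im = 0 := by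
  have hdet := det_resolvent_ne_zero_of_lyapunov hX hL hz
  apply Matrix.ext_of_mulVec_single
  intro i
  obtain ⟨a, b, -, hb, hab⟩ := h.exists_im_transferEval hdet (Pi.single i 1)
  have hb0 : b = 0 := by
    have h1 : (z • (1 : Matrix (Fin n) (Fin n) ℂ) - A.map (algebraMap ℝ ℂ)) *ᵥ
        (fun i => (b i : ℂ)) = 0 := by
      rw [Matrix.sub_mulVec, Matrix.smul_mulVec, Matrix.one_mulVec, map_mulVec_ofReal, hb, him]
      have hzr : z = (z.re : ℂ) := Complex.ext (by simp) (by simp [him])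
      ext i
      rw [hzr]
      simp
    have h2 := Matrix.eq_zero_of_mulVec_eq_zero hdet h1
    ext i
    exact Complex.ofReal_eq_zero.mp (congrFun h2 i)
  rw [hab, hb0, Matrix.mulVec_zero, Matrix.zero_mulVec]

/-- Symmetry of G makes i(G - G*) the real symmetric matrix -2 Im G, so semidefiniteness may be
tested on real vectors. -/
theorem isDiscreteNegImag_of_stateSpaceCondition (h : IsRealization G A B C D) (hG : G = Gᵀ)
    (hminus : (1 - A).det ≠ 0) (hc : NegImagStateSpaceCondition A B C D) :
    IsDiscreteNegImag (transferEval G) := by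
  obtain ⟨-, X, hXs, hX, hL, hC⟩ := hc
  have hsym : ∀ z, (transferEval G z)ᵀ = transferEval G z := fun z => by
    conv_rhs => rw [hG]
    rfl
  have hI : ∀ z, Complex.I • (transferEval G z - (transferEval G z)ᴴ) =
      ((-2 : ℝ) • (transferEval G z).map Complex.im).map (algebraMap ℝ ℂ) := by
    intro z
    ext i j
    have h1 : transferEval G z j i = transferEval G z i j := congrFun (congrFun (hsym z) i) j
    apply Complex.ext
    · simp [h1]; ring
    · simp [h1]
  have hps : ∀ z (t : ℝ), (∀ v, 0 ≤ t * (v ⬝ᵥ ((transferEval G z).map Complex.im *ᵥ v))) →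
      ((t • (transferEval G z).map Complex.im).map (algebraMap ℝ ℂ)).PosSemidef := by
    intro z t ht
    refine (Matrix.PosSemidef.of_dotProduct_mulVec_nonneg ?_ fun v => ?_).map_algebraMap_complex
    · rw [Matrix.IsHermitian, Matrix.conjTranspose_eq_transpose_of_trivial, Matrix.transpose_smul,
        ← Matrix.transpose_map, hsym]
    · rw [star_trivial, Matrix.smul_mulVec, dotProduct_smul, smul_eq_mul]
      exact ht v
  refine ⟨fun i j z hz => h.analyticAt_transferEval (det_resolvent_ne_zero_of_lyapunov hX hL hz) i j,
    fun z hz him => ?_, fun z hz him => ?_, fun z hz him => ?_⟩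
  · rw [hI]
    refine hps z (-2) fun v => ?_
    have := im_transferEval_nonpos h hminus hXs hX hL hC hz v
    nlinarith
  · rw [hI, im_transferEval_eq_zero h hX hL hz him]
    simp
  · rw [hI]
    have : -((-2 : ℝ) • (transferEval G z).map Complex.im).map (algebraMap ℝ ℂ) =
        ((2 : ℝ) • (transferEval G z).map Complex.im).map (algebraMap ℝ ℂ) := by
      ext i j; simp
    rw [this]
    refine hps z 2 fun v => ?_
    have := im_transferEval_nonpos h hminus hXs hX hL hC hz v
    nlinarith

end Sufficiency

/-! ### Eigenvalues of a minimal realization are poles -/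

section Poles

open Filter Topology Asymptotics

variable {m n : ℕ} {G : Matrix (Fin m) (Fin m) (RatFunc ℝ)}
  {A X : Matrix (Fin n) (Fin n) ℝ} {B : Matrix (Fin n) (Fin m) ℝ}
  {C : Matrix (Fin m) (Fin n) ℝ} {D : Matrix (Fin m) (Fin m) ℝ}

theorem eventually_det_resolvent_ne_zero (A : Matrix (Fin n) (Fin n) ℝ) (z₀ : ℂ) :
    ∀ᶠ z in 𝓝[≠] z₀,
      (z • (1 : Matrix (Fin n) (Fin n) ℂ) - A.map (algebraMap ℝ ℂ)).det ≠ 0 := by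
  have hp : A.charpoly.map (algebraMap ℝ ℂ) ≠ 0 := (A.charpoly_monic.map _).ne_zero
  have hfin : ((A.charpoly.map (algebraMap ℝ ℂ)).roots.toFinset : Set ℂ).Finite :=
    Finset.finite_toSet _
  have h1 : ((A.charpoly.map (algebraMap ℝ ℂ)).roots.toFinset \ {z₀} : Set ℂ)ᶜ ∈ 𝓝 z₀ :=
    (hfin.subset Set.sdiff_subset).isClosed.isOpen_compl.mem_nhds (by simp)
  filter_upwards [nhdsWithin_le_nhds h1, self_mem_nhdsWithin] with z hz hz0 h0
  apply hz
  refine ⟨?_, hz0⟩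
  rw [← eval₂_charpoly] at h0
  simp [hp, Polynomial.IsRoot, Polynomial.eval_map, h0]

theorem IsMinimalRealization.det_resolvent_ne_zero (h : IsMinimalRealization G A B C D) {z₀ : ℂ}
    (hcont : ∀ i j, ContinuousAt (fun z => transferEval G z i j) z₀) :
    (z₀ • (1 : Matrix (Fin n) (Fin n) ℂ) - A.map (algebraMap ℝ ℂ)).det ≠ 0 := by
  intro h0
  obtain ⟨b, hb0, hb⟩ := Matrix.exists_mulVec_eq_zero_iff.mpr h0
  apply hb0
  set A' := A.map (algebraMap ℝ ℂ) with hA'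
  set C' := C.map (algebraMap ℝ ℂ) with hC'
  let R : ℂ → Matrix (Fin n) (Fin n) ℂ := fun z => (z • (1 : Matrix (Fin n) (Fin n) ℂ) - A')⁻¹
  have hev := eventually_det_resolvent_ne_zero A z₀
  -- W collects the vectors y with C(z-A)⁻¹y bounded near z₀. Its real vectors form an A-invariant
  -- space, as (z-A)⁻¹Ay = z(z-A)⁻¹y - y, and contain the range of B, as G is continuous at z₀;
  -- controllability makes W everything.
  let W : Submodule ℂ (Fin n → ℂ) :=
    { carrier := {b | (fun z => C' *ᵥ (R z *ᵥ b)) =O[𝓝[≠] z₀] (fun _ => (1 : ℂ))}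
      add_mem' := fun {a b} ha hb => by
        simpa only [Set.mem_ofPred_eq, Matrix.mulVec_add] using IsBigO.add ha hb
      zero_mem' := by
        simpa only [Set.mem_ofPred_eq, Matrix.mulVec_zero] using isBigO_zero _ _
      smul_mem' := fun c a ha => by
        simp only [Set.mem_ofPred_eq, Matrix.mulVec_smul]
        exact IsBigO.const_smul_left ha c }
  let V : Submodule ℝ (Fin n → ℝ) :=
    { carrier := {x | (fun i => (x i : ℂ)) ∈ W}
      add_mem' := fun {a b} ha hb => by
        have := W.add_mem ha hb
        simp only [Set.mem_ofPred_eq, Pi.add_apply, Complex.ofReal_add]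
        exact this
      zero_mem' := by
        simp only [Set.mem_ofPred_eq, Pi.zero_apply, Complex.ofReal_zero]
        exact W.zero_mem
      smul_mem' := fun c a ha => by
        have := W.smul_mem (c : ℂ) ha
        simp only [Set.mem_ofPred_eq, Pi.smul_apply, smul_eq_mul, Complex.ofReal_mul]
        exact this }
  have hV : V = ⊤ := by
    refine h.eq_top_of_invariant V (fun x hx => ?_) (fun u => ?_)
    · change (fun i => ((A *ᵥ x) i : ℂ)) ∈ W
      rw [← map_mulVec_ofReal]
      set y : Fin n → ℂ := fun i => (x i : ℂ)
      have hy : (fun z => C' *ᵥ (R z *ᵥ y)) =O[𝓝[≠] z₀] (fun _ => (1 : ℂ)) := hx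
      have hz : (fun z : ℂ => z) =O[𝓝[≠] z₀] (fun _ => (1 : ℂ)) :=
        (tendsto_id.mono_left nhdsWithin_le_nhds : Tendsto (fun z : ℂ => z) (𝓝[≠] z₀) (𝓝 z₀)).isBigO_one ℂ
      have h1 : (fun z : ℂ => z • (C' *ᵥ (R z *ᵥ y)) - C' *ᵥ y) =O[𝓝[≠] z₀] (fun _ => (1 : ℂ)) := by
        have := hz.smul hy
        simp only [smul_eq_mul, mul_one] at this
        exact this.sub (isBigO_const_const _ one_ne_zero _)
      refine h1.congr' ?_ EventuallyEq.rfl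
      filter_upwards [hev] with z hz
      have h2 : R z *ᵥ (z • y - A' *ᵥ y) = y := by
        have : z • y - A' *ᵥ y = (z • (1 : Matrix (Fin n) (Fin n) ℂ) - A') *ᵥ y := by
          rw [Matrix.sub_mulVec, Matrix.smul_mulVec, Matrix.one_mulVec]
        rw [this, Matrix.mulVec_mulVec, Matrix.nonsing_inv_mul _ (isUnit_iff_ne_zero.mpr hz),
          Matrix.one_mulVec]
      rw [Matrix.mulVec_sub, Matrix.mulVec_smul] at h2
      rw [sub_eq_iff_eq_add] at h2
      change z • (C' *ᵥ (R z *ᵥ y)) - C' *ᵥ y = C' *ᵥ (R z *ᵥ (A' *ᵥ y))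
      rw [← Matrix.mulVec_smul, h2, Matrix.mulVec_add, add_sub_cancel_left]
    · change (fun i => ((B *ᵥ u) i : ℂ)) ∈ W
      rw [← map_mulVec_ofReal]
      set y : Fin m → ℂ := fun i => (u i : ℂ)
      have h1 : ContinuousAt (fun z => (transferEval G z - D.map (algebraMap ℝ ℂ)) *ᵥ y) z₀ := by
        refine continuousAt_pi.mpr fun i => ?_
        simp only [Matrix.mulVec, dotProduct, Matrix.sub_apply]
        exact tendsto_finsetSum _ fun j _ =>
          ((hcont i j).sub continuousAt_const).mul continuousAt_const
      have h2 := ((h1.tendsto.mono_left nhdsWithin_le_nhds :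
        Tendsto _ (𝓝[≠] z₀) _)).isBigO_one ℂ
      refine IsBigO.congr' h2 ?_ EventuallyEq.rfl
      filter_upwards [hev] with z hz
      rw [h.1.transferEval_eq hz, add_sub_cancel_right, ← Matrix.mulVec_mulVec,
        ← Matrix.mulVec_mulVec]
  have hbW : b ∈ W := by
    have hre : (fun i => (((b i).re : ℝ) : ℂ)) ∈ W :=
      (hV ▸ Submodule.mem_top : (fun i => (b i).re) ∈ V)
    have him : (fun i => (((b i).im : ℝ) : ℂ)) ∈ W :=
      (hV ▸ Submodule.mem_top : (fun i => (b i).im) ∈ V)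
    have h1 := W.add_mem hre (W.smul_mem Complex.I him)
    convert h1 using 1
    ext i
    simp only [Pi.add_apply, Pi.smul_apply, smul_eq_mul]
    rw [mul_comm, Complex.re_add_im]
  have hAb : A' *ᵥ b = z₀ • b := by
    rw [Matrix.sub_mulVec, Matrix.smul_mulVec, Matrix.one_mulVec, sub_eq_zero] at hb
    exact hb.symm
  -- On the eigenvector C(z-A)⁻¹b = (z-z₀)⁻¹Cb, which is bounded only if Cb = 0; observability then
  -- kills b.
  have hCb : C' *ᵥ b = 0 := by
    have h1 : (fun z : ℂ => (z - z₀) • (C' *ᵥ (R z *ᵥ b))) =O[𝓝[≠] z₀] (fun z => (z - z₀)) := by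
      have := (isBigO_refl (fun z : ℂ => z - z₀) (𝓝[≠] z₀)).smul hbW
      simpa only [smul_eq_mul, mul_one] using this
    have h2 : (fun z : ℂ => (z - z₀) • (C' *ᵥ (R z *ᵥ b))) =ᶠ[𝓝[≠] z₀] fun _ => C' *ᵥ b := by
      filter_upwards [hev] with z hz
      have h3 : R z *ᵥ ((z - z₀) • b) = b := by
        have : (z - z₀) • b = (z • (1 : Matrix (Fin n) (Fin n) ℂ) - A') *ᵥ b := by
          rw [Matrix.sub_mulVec, Matrix.smul_mulVec, Matrix.one_mulVec, hAb, sub_smul]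
        rw [this, Matrix.mulVec_mulVec, Matrix.nonsing_inv_mul _ (isUnit_iff_ne_zero.mpr hz),
          Matrix.one_mulVec]
      rw [← Matrix.mulVec_smul, ← Matrix.mulVec_smul, h3]
    have h4 : Tendsto (fun z : ℂ => z - z₀) (𝓝[≠] z₀) (𝓝 0) := by
      have : Tendsto (fun z : ℂ => z - z₀) (𝓝 z₀) (𝓝 (z₀ - z₀)) :=
        (continuous_id.sub continuous_const).tendsto z₀
      rw [sub_self] at this
      exact this.mono_left nhdsWithin_le_nhds
    have h5 := h1.trans_tendsto h4
    exact tendsto_nhds_unique (tendsto_const_nhds.congr' h2.symm) h5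
  have hpow : ∀ k : ℕ, (A ^ k).map (algebraMap ℝ ℂ) *ᵥ b = z₀ ^ k • b := by
    intro k
    induction k with
    | zero => simp
    | succ k ih =>
      rw [pow_succ, Matrix.map_mul, ← Matrix.mulVec_mulVec, ← hA', hAb, Matrix.mulVec_smul, ih,
        smul_smul, pow_succ']
  have hk : ∀ k : ℕ, C' *ᵥ ((A ^ k).map (algebraMap ℝ ℂ) *ᵥ b) = 0 := fun k => by
    rw [hpow, Matrix.mulVec_smul, hCb, smul_zero]
  have hre : (fun i => (b i).re) = 0 := h.eq_zero_of_unobservable fun k => by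
    ext i
    have := congrArg Complex.re (congrFun (hk k) i)
    rw [re_map_mulVec] at this
    simp only [re_map_mulVec] at this
    exact this
  have him : (fun i => (b i).im) = 0 := h.eq_zero_of_unobservable fun k => by
    ext i
    have := congrArg Complex.im (congrFun (hk k) i)
    rw [im_map_mulVec] at this
    simp only [im_map_mulVec] at this
    exact this
  ext i
  exact Complex.ext (congrFun hre i) (congrFun him i)

end Poles

/-! ### Infima of quadratic functions that are quadratic -/

section InfQuadratic

variable {E ι : Type*} [AddCommGroup E] [Module ℝ E]

/-- A real function that is homogeneous of degree two and invariant under the reflections of pairs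
of vectors is a quadratic form. -/
theorem exists_quadraticMap_of_reflection (V : E → ℝ) (hsmul : ∀ (t : ℝ) x, V (t • x) = t ^ 2 * V x)
    (href : ∀ c s : ℝ, c ^ 2 + s ^ 2 = 1 → ∀ x y,
      V (c • x + s • y) + V (s • x - c • y) = V x + V y) :
    ∃ Q : QuadraticMap ℝ E ℝ, ∀ x, Q x = V x := by
  -- The reflection with c = √t, s = √(1-t), applied to (cx, sy). Having all angles available yields
  -- real homogeneity of the polar form without any continuity of V.
  have hconv : ∀ t : ℝ, 0 ≤ t → t ≤ 1 → ∀ x y,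
      V (t • x + (1 - t) • y) + t * (1 - t) * V (x - y) = t * V x + (1 - t) * V y := by
    intro t h0 h1 x y
    have hc := Real.sq_sqrt h0
    have hs := Real.sq_sqrt (sub_nonneg.mpr h1)
    set c := √t
    set s := √(1 - t)
    have := href c s (by rw [hc, hs]; ring) (c • x) (s • y)
    rw [smul_smul, smul_smul, smul_smul, smul_smul, mul_comm s c, ← smul_sub, hsmul, hsmul, hsmul,
      ← sq, ← sq, mul_pow, hc, hs] at this
    exact this
  have hpar : ∀ x y, V (x + y) + V (x - y) = 2 * V x + 2 * V y := by
    intro x y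
    have h1 := hconv (1 / 2) (by norm_num) (by norm_num) ((2 : ℝ) • x) ((2 : ℝ) • y)
    rw [← smul_sub, hsmul, hsmul, hsmul] at h1
    have h2 : (1 / 2 : ℝ) • (2 : ℝ) • x + (1 - 1 / 2 : ℝ) • (2 : ℝ) • y = x + y := by module
    rw [h2] at h1
    linarith
  have hV0 : V 0 = 0 := by simpa using hsmul 0 0
  have hneg : ∀ x, V (-x) = V x := fun x => by simpa using hsmul (-1) x
  have hadd : ∀ x y z, QuadraticMap.polar V (x + y) z =
      QuadraticMap.polar V x z + QuadraticMap.polar V y z := by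
    intro x y z
    simp only [QuadraticMap.polar]
    have h1 := hpar (x + z) y
    have h2 := hpar x (z - y)
    have h3 := hpar (x + y) z
    have h4 := hpar z y
    rw [show x + z + y = x + y + z by abel, show x + z - y = x + (z - y) by abel] at h1
    rw [show x - (z - y) = x + y - z by abel] at h2
    rw [add_comm y z]
    linarith
  have hcomm : ∀ x y, QuadraticMap.polar V x y = QuadraticMap.polar V y x :=
    QuadraticMap.polar_comm V
  have hunit : ∀ t : ℝ, 0 ≤ t → t ≤ 1 → ∀ x y,
      QuadraticMap.polar V (t • x) y = t * QuadraticMap.polar V x y := by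
    intro t h0 h1 x y
    have := hconv t h0 h1 (x + y) y
    rw [show t • (x + y) + (1 - t) • y = t • x + y by module, add_sub_cancel_right] at this
    simp only [QuadraticMap.polar, hsmul]
    linarith
  have hnonneg : ∀ t : ℝ, 0 ≤ t → ∀ x y,
      QuadraticMap.polar V (t • x) y = t * QuadraticMap.polar V x y := by
    intro t h0 x y
    rcases le_total t 1 with h1 | h1
    · exact hunit t h0 h1 x y
    · have ht : t ≠ 0 := by linarith
      have := hunit t⁻¹ (inv_nonneg.mpr h0) (inv_le_one_of_one_le₀ h1) (t • x) y
      rw [smul_smul, inv_mul_cancel₀ ht, one_smul] at this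
      rw [this, ← mul_assoc, mul_inv_cancel₀ ht, one_mul]
  have hall : ∀ (t : ℝ) x y,
      QuadraticMap.polar V (t • x) y = t • QuadraticMap.polar V x y := by
    intro t x y
    rw [smul_eq_mul]
    rcases le_total 0 t with h0 | h0
    · exact hnonneg t h0 x y
    · have h1 := hnonneg (-t) (neg_nonneg.mpr h0) x y
      have h2 := hadd (t • x) (-t • x) y
      rw [← add_smul, add_neg_cancel, zero_smul] at h2
      have h3 : QuadraticMap.polar V 0 y = 0 := by simp [QuadraticMap.polar, hV0]
      linarith
  exact ⟨QuadraticMap.ofPolar V (fun a x => by rw [hsmul, smul_eq_mul, sq]) hadd hall, fun _ => rfl⟩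

/-- The infimum of a family of real functions closed under rescaling and under reflections of pairs
is a quadratic form. -/
theorem exists_quadraticMap_iInf [Nonempty ι] (q : ι → E → ℝ)
    (hbdd : ∀ x, BddBelow (Set.range fun i => q i x))
    (hsmul : ∀ (t : ℝ) i, ∃ j, ∀ x, q j (t • x) = t ^ 2 * q i x)
    (href : ∀ c s : ℝ, c ^ 2 + s ^ 2 = 1 → ∀ i j, ∃ k l, ∀ x y,
      q k (c • x + s • y) + q l (s • x - c • y) = q i x + q j y) :
    ∃ Q : QuadraticMap ℝ E ℝ, ∀ x, Q x = ⨅ i, q i x := by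
  set V : E → ℝ := fun x => ⨅ i, q i x with hV
  have hle : ∀ i x, V x ≤ q i x := fun i x => ciInf_le (hbdd x) i
  have hsm_le : ∀ (t : ℝ) x, V (t • x) ≤ t ^ 2 * V x := by
    intro t x
    rw [hV]
    simp only
    rw [Real.mul_iInf_of_nonneg (sq_nonneg t)]
    refine le_ciInf fun i => ?_
    obtain ⟨j, hj⟩ := hsmul t i
    rw [← hj]
    exact hle j _
  have hV0 : V 0 = 0 := by
    have h1 := hsm_le 0 0
    have h2 := hsm_le 2 0
    simp only [smul_zero] at h1 h2
    linarith
  refine exists_quadraticMap_of_reflection V (fun t x => ?_) ?_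
  · rcases eq_or_ne t 0 with rfl | ht
    · simp [hV0]
    · refine le_antisymm (hsm_le t x) ?_
      have h1 := hsm_le t⁻¹ (t • x)
      rw [smul_smul, inv_mul_cancel₀ ht, one_smul, inv_pow, ← div_eq_inv_mul,
        le_div_iff₀ (by positivity)] at h1
      linarith
  · have hle2 : ∀ c s : ℝ, c ^ 2 + s ^ 2 = 1 → ∀ x y,
        V (c • x + s • y) + V (s • x - c • y) ≤ V x + V y := by
      intro c s hcs x y
      refine le_of_forall_pos_le_add fun ε hε => ?_
      obtain ⟨i, hi⟩ := exists_lt_of_ciInf_lt (show (⨅ i, q i x) < V x + ε / 2 by simp [hV, hε])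
      obtain ⟨j, hj⟩ := exists_lt_of_ciInf_lt (show (⨅ i, q i y) < V y + ε / 2 by simp [hV, hε])
      obtain ⟨k, l, hkl⟩ := href c s hcs i j
      have := hkl x y
      have h1 := hle k (c • x + s • y)
      have h2 := hle l (s • x - c • y)
      linarith
    intro c s hcs x y
    refine le_antisymm (hle2 c s hcs x y) ?_
    -- The reflection is an involution, so the same inequality at the reflected pair is the reverse
    -- one.
    have := hle2 c s hcs (c • x + s • y) (s • x - c • y)
    have h1 : c • (c • x + s • y) + s • (s • x - c • y) = x := by
      calc _ = (c ^ 2 + s ^ 2) • x := by module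
        _ = x := by rw [hcs, one_smul]
    have h2 : s • (c • x + s • y) - c • (s • x - c • y) = y := by
      calc _ = (c ^ 2 + s ^ 2) • y := by module
        _ = y := by rw [hcs, one_smul]
    rwa [h1, h2] at this

end InfQuadratic

/-! ### Supplied energy and the available storage -/

section Storage

variable {m n : ℕ}

/-- The energy supplied during the first `T` steps to the system `x ↦ A x + B u`, `y = C x + J u`,
started at `x` and driven by the input sequence `u`. -/
def suppliedEnergy (A : Matrix (Fin n) (Fin n) ℝ) (B : Matrix (Fin n) (Fin m) ℝ)
    (C : Matrix (Fin m) (Fin n) ℝ) (J : Matrix (Fin m) (Fin m) ℝ) :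
    ℕ → (ℕ → Fin m → ℝ) → (Fin n → ℝ) → ℝ
  | 0, _, _ => 0
  | T + 1, u, x => u 0 ⬝ᵥ (C *ᵥ x + J *ᵥ u 0) +
      suppliedEnergy A B C J T (fun k => u (k + 1)) (A *ᵥ x + B *ᵥ u 0)

variable (A : Matrix (Fin n) (Fin n) ℝ) (B : Matrix (Fin n) (Fin m) ℝ)
  (C : Matrix (Fin m) (Fin n) ℝ) (J : Matrix (Fin m) (Fin m) ℝ)

theorem suppliedEnergy_zero_input (T : ℕ) (x : Fin n → ℝ) :
    suppliedEnergy A B C J T 0 x = 0 := by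
  induction T generalizing x with
  | zero => rfl
  | succ T ih =>
    have : (fun k => (0 : ℕ → Fin m → ℝ) (k + 1)) = 0 := rfl
    rw [suppliedEnergy, this, ih]
    simp

/-- The input sequence `u` followed by `w`. -/
def consInput (u : Fin m → ℝ) (w : ℕ → Fin m → ℝ) : ℕ → Fin m → ℝ
  | 0 => u
  | k + 1 => w k

theorem suppliedEnergy_consInput (T : ℕ) (u : Fin m → ℝ) (w : ℕ → Fin m → ℝ) (x : Fin n → ℝ) :
    suppliedEnergy A B C J (T + 1) (consInput u w) x = u ⬝ᵥ (C *ᵥ x + J *ᵥ u) +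
      suppliedEnergy A B C J T w (A *ᵥ x + B *ᵥ u) := rfl

/-- The energy is a quadratic form in (u, x) jointly and p is its polar value. What matters is that
p does not depend on a and b, so that cross terms cancel under reflections. -/
theorem suppliedEnergy_combination (T : ℕ) (u v : ℕ → Fin m → ℝ) (x y : Fin n → ℝ) :
    ∃ p : ℝ, ∀ a b : ℝ, suppliedEnergy A B C J T (a • u + b • v) (a • x + b • y) =
      a ^ 2 * suppliedEnergy A B C J T u x + a * b * p + b ^ 2 * suppliedEnergy A B C J T v y := by
  induction T generalizing u v x y with
  | zero => exact ⟨0, fun a b => by simp [suppliedEnergy]⟩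
  | succ T ih =>
    obtain ⟨p, hp⟩ := ih (fun k => u (k + 1)) (fun k => v (k + 1)) (A *ᵥ x + B *ᵥ u 0)
      (A *ᵥ y + B *ᵥ v 0)
    refine ⟨u 0 ⬝ᵥ (C *ᵥ y + J *ᵥ v 0) + v 0 ⬝ᵥ (C *ᵥ x + J *ᵥ u 0) + p, fun a b => ?_⟩
    have h1 : A *ᵥ (a • x + b • y) + B *ᵥ (a • u + b • v) 0 =
        a • (A *ᵥ x + B *ᵥ u 0) + b • (A *ᵥ y + B *ᵥ v 0) := by
      simp only [Pi.add_apply, Pi.smul_apply, Matrix.mulVec_add, Matrix.mulVec_smul]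
      module
    have h2 : (fun k => (a • u + b • v) (k + 1)) =
        a • (fun k => u (k + 1)) + b • (fun k => v (k + 1)) := rfl
    rw [suppliedEnergy, h1, h2, hp, suppliedEnergy, suppliedEnergy]
    simp only [Pi.add_apply, Pi.smul_apply, Matrix.mulVec_add, Matrix.mulVec_smul, dotProduct_add,
      add_dotProduct, smul_dotProduct, dotProduct_smul, smul_eq_mul]
    ring

theorem suppliedEnergy_smul (T : ℕ) (u : ℕ → Fin m → ℝ) (x : Fin n → ℝ) (t : ℝ) :
    suppliedEnergy A B C J T (t • u) (t • x) = t ^ 2 * suppliedEnergy A B C J T u x := by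
  obtain ⟨p, hp⟩ := suppliedEnergy_combination A B C J T u u x x
  simpa using hp t 0

theorem suppliedEnergy_reflection (T : ℕ) (u v : ℕ → Fin m → ℝ) (x y : Fin n → ℝ) (c s : ℝ) :
    suppliedEnergy A B C J T (c • u + s • v) (c • x + s • y) +
        suppliedEnergy A B C J T (s • u - c • v) (s • x - c • y) =
      (c ^ 2 + s ^ 2) * (suppliedEnergy A B C J T u x + suppliedEnergy A B C J T v y) := by
  obtain ⟨p, hp⟩ := suppliedEnergy_combination A B C J T u v x y
  have h1 := hp c s
  have h2 := hp s (-c)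
  simp only [neg_smul, ← sub_eq_add_neg] at h2
  rw [h1, h2]
  ring

/-- Following u for T steps by zero input supplies nothing more. This brings inputs with different
horizons to a common one before they are combined. -/
theorem exists_suppliedEnergy_extend (T : ℕ) (u : ℕ → Fin m → ℝ) :
    ∃ v, ∀ x, suppliedEnergy A B C J (T + 1) v x = suppliedEnergy A B C J T u x := by
  induction T generalizing u with
  | zero => exact ⟨0, fun x => suppliedEnergy_zero_input A B C J 1 x⟩
  | succ T ih =>
    obtain ⟨v, hv⟩ := ih fun k => u (k + 1)
    refine ⟨consInput (u 0) v, fun x => ?_⟩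
    rw [suppliedEnergy_consInput, suppliedEnergy]
    exact congrArg _ (hv _)

theorem exists_suppliedEnergy_extend_of_le {T T' : ℕ} (h : T ≤ T') (u : ℕ → Fin m → ℝ) :
    ∃ v, ∀ x, suppliedEnergy A B C J T' v x = suppliedEnergy A B C J T u x := by
  induction T', h using Nat.le_induction with
  | base => exact ⟨u, fun _ => rfl⟩
  | succ T' _ ih =>
    obtain ⟨v, hv⟩ := ih
    obtain ⟨w, hw⟩ := exists_suppliedEnergy_extend A B C J T' v
    exact ⟨w, fun x => (hw x).trans (hv x)⟩

variable {A B C J}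

/-- The states with energy bounded below form a subspace; prefixing one input step shows that it is
stable under the dynamics, so reachability makes it everything. -/
theorem bddBelow_suppliedEnergy
    (hreach : ∀ W : Submodule ℝ (Fin n → ℝ), (∀ x ∈ W, A *ᵥ x ∈ W) → (∀ u, B *ᵥ u ∈ W) → W = ⊤)
    (hpos : ∀ T u, 0 ≤ suppliedEnergy A B C J T u 0) (x : Fin n → ℝ) :
    ∃ c : ℝ, ∀ T u, -c ≤ suppliedEnergy A B C J T u x := by
  have hstep : ∀ x u, (∃ c : ℝ, ∀ T u, -c ≤ suppliedEnergy A B C J T u x) →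
      ∃ c : ℝ, ∀ T u', -c ≤ suppliedEnergy A B C J T u' (A *ᵥ x + B *ᵥ u) := by
    rintro x u ⟨c, hc⟩
    refine ⟨c + u ⬝ᵥ (C *ᵥ x + J *ᵥ u), fun T u' => ?_⟩
    have := hc (T + 1) (consInput u u')
    rw [suppliedEnergy_consInput] at this
    linarith
  let W : Submodule ℝ (Fin n → ℝ) :=
    { carrier := {x | ∃ c : ℝ, ∀ T u, -c ≤ suppliedEnergy A B C J T u x}
      add_mem' := by
        rintro x y ⟨c, hc⟩ ⟨d, hd⟩
        refine ⟨2 * c + 2 * d, fun T u => ?_⟩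
        -- With c = s = 1 and the input u/2 twice, the state x - y receives zero input and
        -- contributes nothing, so E(u, x+y) = 2(E(u/2, x) + E(u/2, y)).
        have h1 := suppliedEnergy_reflection A B C J T ((1 / 2 : ℝ) • u) ((1 / 2 : ℝ) • u) x y 1 1
        simp only [one_smul] at h1
        rw [sub_self, suppliedEnergy_zero_input,
          ← add_smul] at h1
        norm_num at h1
        have h2 := hc T ((1 / 2 : ℝ) • u)
        have h3 := hd T ((1 / 2 : ℝ) • u)
        norm_num at h2 h3
        linarith
      zero_mem' := ⟨0, fun T u => by simpa using hpos T u⟩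
      smul_mem' := by
        rintro t x ⟨c, hc⟩
        rcases eq_or_ne t 0 with rfl | ht
        · exact ⟨0, fun T u => by simpa using hpos T u⟩
        · refine ⟨t ^ 2 * c, fun T u => ?_⟩
          have h1 := suppliedEnergy_smul A B C J T (t⁻¹ • u) x t
          rw [smul_smul, mul_inv_cancel₀ ht, one_smul] at h1
          rw [h1, ← mul_neg]
          exact mul_le_mul_of_nonneg_left (hc T _) (sq_nonneg t) }
  have hW : W = ⊤ := by
    refine hreach W (fun x hx => ?_) (fun u => ?_)
    · have := hstep x 0 hx
      rwa [Matrix.mulVec_zero, add_zero] at this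
    · have := hstep 0 u W.zero_mem
      rwa [Matrix.mulVec_zero, zero_add] at this
  exact (hW ▸ Submodule.mem_top : x ∈ W)

/-- A reachable system which can only absorb energy from its rest state has a quadratic storage
function. -/
theorem exists_storage
    (hreach : ∀ W : Submodule ℝ (Fin n → ℝ), (∀ x ∈ W, A *ᵥ x ∈ W) → (∀ u, B *ᵥ u ∈ W) → W = ⊤)
    (hpos : ∀ T u, 0 ≤ suppliedEnergy A B C J T u 0) :
    ∃ X : Matrix (Fin n) (Fin n) ℝ, X = Xᵀ ∧ (∀ x, 0 ≤ x ⬝ᵥ (X *ᵥ x)) ∧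
      ∀ x u, (A *ᵥ x + B *ᵥ u) ⬝ᵥ (X *ᵥ (A *ᵥ x + B *ᵥ u)) ≤
        x ⬝ᵥ (X *ᵥ x) + u ⬝ᵥ (C *ᵥ x + J *ᵥ u) := by
  let q : ℕ × (ℕ → Fin m → ℝ) → (Fin n → ℝ) → ℝ := fun i x => suppliedEnergy A B C J i.1 i.2 x
  have hbdd : ∀ x, BddBelow (Set.range fun i => q i x) := by
    intro x
    obtain ⟨c, hc⟩ := bddBelow_suppliedEnergy hreach hpos x
    exact ⟨-c, by rintro _ ⟨i, rfl⟩; exact hc i.1 i.2⟩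
  obtain ⟨Q, hQ⟩ := exists_quadraticMap_iInf q hbdd
    (fun t i => ⟨(i.1, t • i.2), fun x => suppliedEnergy_smul A B C J i.1 i.2 x t⟩) (by
      intro c s hcs i j
      obtain ⟨u, hu⟩ := exists_suppliedEnergy_extend_of_le A B C J (le_max_left i.1 j.1) i.2
      obtain ⟨v, hv⟩ := exists_suppliedEnergy_extend_of_le A B C J (le_max_right i.1 j.1) j.2
      refine ⟨(max i.1 j.1, c • u + s • v), (max i.1 j.1, s • u - c • v), fun x y => ?_⟩
      have := suppliedEnergy_reflection A B C J (max i.1 j.1) u v x y c s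
      rw [hcs, one_mul, hu, hv] at this
      exact this)
  let X : Matrix (Fin n) (Fin n) ℝ := LinearMap.BilinForm.toMatrix' (QuadraticMap.associated (-Q))
  have hXb : ∀ x y, x ⬝ᵥ (X *ᵥ y) = QuadraticMap.associated (R := ℝ) (-Q) x y := by
    intro x y
    rw [← Matrix.toBilin'_apply', Matrix.toBilin'_toMatrix']
  have hXQ : ∀ x, x ⬝ᵥ (X *ᵥ x) = -Q x := by
    intro x
    rw [hXb, QuadraticMap.associated_eq_self_apply]; rfl
  refine ⟨X, ?_, fun x => ?_, fun x u => ?_⟩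
  · ext i j
    have h1 := hXb (Pi.single i 1) (Pi.single j 1)
    have h2 := hXb (Pi.single j 1) (Pi.single i 1)
    have h3 : QuadraticMap.associated (R := ℝ) (-Q) (Pi.single i 1) (Pi.single j 1) =
        QuadraticMap.associated (R := ℝ) (-Q) (Pi.single j 1) (Pi.single i 1) :=
      QuadraticMap.associated_isSymm ℝ (-Q) _ _
    rw [← h1, ← h2] at h3
    simpa using h3
  · rw [hXQ, hQ, neg_nonneg]
    exact ciInf_le (hbdd x) (0, 0)
  · rw [hXQ, hXQ, hQ, hQ]
    -- Dynamic programming: applying u first and then any input from the next state is one of the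
    -- competitors at x.
    have : (⨅ i, q i x) - u ⬝ᵥ (C *ᵥ x + J *ᵥ u) ≤ ⨅ i, q i (A *ᵥ x + B *ᵥ u) := by
      refine le_ciInf fun i => ?_
      have h1 : (⨅ i, q i x) ≤ u ⬝ᵥ (C *ᵥ x + J *ᵥ u) + q i (A *ᵥ x + B *ᵥ u) :=
        ciInf_le (hbdd x) (i.1 + 1, consInput u i.2)
      linarith
    linarith

end Storage

/-! ### From the storage function to the state-space condition -/

section StorageToLyapunov

variable {m n : ℕ} {G : Matrix (Fin m) (Fin m) (RatFunc ℝ)}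
  {A X : Matrix (Fin n) (Fin n) ℝ} {B : Matrix (Fin n) (Fin m) ℝ}
  {C : Matrix (Fin m) (Fin n) ℝ} {D : Matrix (Fin m) (Fin m) ℝ}

/-- For small t of sign opposite to l the linear term wins; t = -l/(|k|+1) is small enough. -/
theorem eq_zero_of_forall_quadratic_nonneg {l k : ℝ} (h : ∀ t : ℝ, 0 ≤ t * l + t ^ 2 * k) :
    l = 0 := by
  by_contra hl
  have hk : 0 < |k| + 1 := by positivity
  have h1 := h (-l / (|k| + 1))
  have h2 : -l / (|k| + 1) * l + (-l / (|k| + 1)) ^ 2 * k =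
      -(l ^ 2 / (|k| + 1) ^ 2) * (|k| + 1 - k) := by
    field_simp
    ring
  rw [h2] at h1
  have h3 : 0 < l ^ 2 / (|k| + 1) ^ 2 := by positivity
  nlinarith [le_abs_self k]

/-- S = (1+A)(1-A)⁻¹ is invertible and commutes with A, so replacing B by SB keeps the pair
reachable. -/
theorem IsMinimalRealization.eq_top_of_invariant_cayley (h : IsMinimalRealization G A B C D)
    (hplus : (1 + A).det ≠ 0) (hminus : (1 - A).det ≠ 0) (W : Submodule ℝ (Fin n → ℝ))
    (hA : ∀ x ∈ W, A *ᵥ x ∈ W) (hB : ∀ u, ((1 + A) * ((1 - A)⁻¹ * B)) *ᵥ u ∈ W) : W = ⊤ := by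
  set S := (1 + A) * (1 - A)⁻¹ with hS
  have hu : IsUnit (1 - A).det := isUnit_iff_ne_zero.mpr hminus
  have hup : IsUnit (1 + A).det := isUnit_iff_ne_zero.mpr hplus
  have hcomm : S * A = A * S := by
    rw [hS, Matrix.mul_assoc, ← mul_one_sub_inv_comm hminus, ← Matrix.mul_assoc,
      ← Matrix.mul_assoc, Matrix.add_mul, Matrix.mul_add, Matrix.one_mul, Matrix.mul_one]
  have hW : W.comap S.mulVecLin = ⊤ := by
    refine h.eq_top_of_invariant _ (fun x hx => ?_) (fun u => ?_)
    · simp only [Submodule.mem_comap, Matrix.mulVecLin_apply] at hx ⊢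
      rw [Matrix.mulVec_mulVec, hcomm, ← Matrix.mulVec_mulVec]
      exact hA _ hx
    · simp only [Submodule.mem_comap, Matrix.mulVecLin_apply]
      rw [Matrix.mulVec_mulVec, hS, Matrix.mul_assoc]
      exact hB u
  rw [Submodule.eq_top_iff']
  intro x
  have hx : ((1 - A) * (1 + A)⁻¹) *ᵥ x ∈ W.comap S.mulVecLin := hW ▸ Submodule.mem_top
  have hinv : S * ((1 - A) * (1 + A)⁻¹) = 1 := by
    rw [hS, Matrix.mul_assoc, ← Matrix.mul_assoc (1 - A)⁻¹, Matrix.nonsing_inv_mul _ hu,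
      Matrix.one_mul, Matrix.mul_nonsing_inv _ hup]
  rwa [Submodule.mem_comap, Matrix.mulVecLin_apply, Matrix.mulVec_mulVec, hinv,
    Matrix.one_mulVec] at hx

theorem IsMinimalRealization.stateSpaceCondition_of_suppliedEnergy_nonneg
    (h : IsMinimalRealization G A B C D)
    (hplus : (1 + A).det ≠ 0) (hminus : (1 - A).det ≠ 0) (hD : D = Dᵀ)
    (hpos : ∀ T u, 0 ≤ suppliedEnergy A ((1 + A) * ((1 - A)⁻¹ * B)) C (C * ((1 - A)⁻¹ * B)) T u 0) :
    NegImagStateSpaceCondition A B C D := by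
  obtain ⟨Y, hYs, hY0, hYd⟩ :=
    exists_storage (h.eq_top_of_invariant_cayley hplus hminus) hpos
  obtain ⟨N, hN⟩ : ∃ N, N = (1 - A)⁻¹ * B := ⟨_, rfl⟩
  rw [← hN] at hYd
  have hYh : Y.IsHermitian := by
    rw [Matrix.IsHermitian, Matrix.conjTranspose_eq_transpose_of_trivial]; exact hYs.symm
  have hYp : Y.PosSemidef :=
    Matrix.PosSemidef.of_dotProduct_mulVec_nonneg hYh fun x => by simpa using hY0 x
  have hYA : ∀ x, (A *ᵥ x) ⬝ᵥ (Y *ᵥ (A *ᵥ x)) ≤ x ⬝ᵥ (Y *ᵥ x) := fun x => by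
    simpa using hYd x 0
  have hCeq : C = Nᵀ * ((2 : ℝ) • Y) * (A + 1) := by
    have key : ∀ u w, u ⬝ᵥ (C *ᵥ w) = 2 * ((N *ᵥ u) ⬝ᵥ (Y *ᵥ ((A + 1) *ᵥ w))) := by
      intro u w
      rw [← sub_eq_zero]
      refine eq_zero_of_forall_quadratic_nonneg
        (k := w ⬝ᵥ (Y *ᵥ w) - (A *ᵥ w) ⬝ᵥ (Y *ᵥ (A *ᵥ w))) fun t => ?_
      -- This state moves to Nu + tAw with output tCw. Since Y takes equal values at -Nu and Nu, the
      -- dissipation inequality has no constant term in t.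
      have h1 := hYd (-(N *ᵥ u) + t • w) u
      have h2 : A *ᵥ (-(N *ᵥ u) + t • w) + ((1 + A) * N) *ᵥ u = N *ᵥ u + t • (A *ᵥ w) := by
        rw [← Matrix.mulVec_mulVec, Matrix.add_mulVec, Matrix.one_mulVec, Matrix.mulVec_add,
          Matrix.mulVec_neg, Matrix.mulVec_smul]
        abel
      have h3 : C *ᵥ (-(N *ᵥ u) + t • w) + (C * N) *ᵥ u = t • (C *ᵥ w) := by
        rw [← Matrix.mulVec_mulVec, Matrix.mulVec_add, Matrix.mulVec_neg, Matrix.mulVec_smul]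
        abel
      rw [h2, h3] at h1
      have h4 := dotProduct_mulVec_comm_of_symm hYs w (N *ᵥ u)
      have h5 := dotProduct_mulVec_comm_of_symm hYs (A *ᵥ w) (N *ᵥ u)
      simp only [Matrix.mulVec_add, Matrix.mulVec_neg, Matrix.mulVec_smul, dotProduct_add,
        add_dotProduct, dotProduct_smul, smul_dotProduct, dotProduct_neg, neg_dotProduct,
        smul_eq_mul, Matrix.add_mulVec, Matrix.one_mulVec] at h1 ⊢
      rw [h4, h5] at h1
      linarith
    ext i j
    have h1 := key (Pi.single i 1) (Pi.single j 1)
    have h2 : (Nᵀ * ((2 : ℝ) • Y) * (A + 1) : Matrix (Fin m) (Fin n) ℝ) i j =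
        Pi.single i 1 ⬝ᵥ ((Nᵀ * ((2 : ℝ) • Y) * (A + 1)) *ᵥ Pi.single j 1) := by simp
    rw [h2, ← Matrix.mulVec_mulVec, ← Matrix.mulVec_mulVec, Matrix.dotProduct_mulVec _ Nᵀ,
      Matrix.vecMul_transpose, Matrix.smul_mulVec, dotProduct_smul, smul_eq_mul, ← h1]
    simp
  -- A null vector of Y stays null along its orbit because A contracts Y; the formula for C then
  -- makes it unobservable.
  have hpd : ∀ x : Fin n → ℝ, x ⬝ᵥ (Y *ᵥ x) = 0 → x = 0 := by
    intro x hx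
    have hxk : ∀ k : ℕ, (A ^ k *ᵥ x) ⬝ᵥ (Y *ᵥ (A ^ k *ᵥ x)) = 0 := by
      intro k
      induction k with
      | zero => simpa using hx
      | succ k ih =>
        refine le_antisymm ?_ (hY0 _)
        rw [pow_succ', ← Matrix.mulVec_mulVec, ← ih]
        exact hYA _
    have hYk : ∀ k : ℕ, Y *ᵥ (A ^ k *ᵥ x) = 0 := fun k =>
      (hYp.dotProduct_mulVec_zero_iff _).mp (by simpa using hxk k)
    refine h.eq_zero_of_unobservable fun k => ?_
    rw [hCeq, ← Matrix.mulVec_mulVec, ← Matrix.mulVec_mulVec, Matrix.smul_mulVec,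
      Matrix.add_mulVec, Matrix.one_mulVec, Matrix.mulVec_add, Matrix.mulVec_mulVec x A,
      ← pow_succ', hYk, hYk]
    simp
  refine ⟨hD, (2 : ℝ) • Y, by rw [Matrix.transpose_smul, ← hYs], ?_, ?_, ?_⟩
  · refine Matrix.PosDef.smul ?_ (by norm_num)
    refine Matrix.PosDef.of_dotProduct_mulVec_pos hYh fun x hx => ?_
    rw [star_trivial]
    exact lt_of_le_of_ne (hY0 x) fun h0 => hx (hpd x h0.symm)
  · refine Matrix.PosSemidef.of_dotProduct_mulVec_nonneg ?_ fun x => ?_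
    · rw [Matrix.IsHermitian, Matrix.conjTranspose_eq_transpose_of_trivial]
      simp only [Matrix.transpose_sub, Matrix.transpose_mul, Matrix.transpose_smul,
        Matrix.transpose_transpose, ← hYs, Matrix.mul_assoc]
    · rw [star_trivial, Matrix.sub_mulVec, dotProduct_sub, ← Matrix.mulVec_mulVec,
        ← Matrix.mulVec_mulVec, Matrix.dotProduct_mulVec x Aᵀ, Matrix.vecMul_transpose,
        Matrix.smul_mulVec, Matrix.smul_mulVec, dotProduct_smul, dotProduct_smul, smul_eq_mul,
        smul_eq_mul]
      linarith [hYA x]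
  · rw [neg_transpose_mul_inv_mul hminus, ← hN]
    exact hCeq

end StorageToLyapunov

/-! ### Averages over the unit circle -/

section CircleAverages

open Real

theorem circleAverage_zpow (l : ℤ) :
    circleAverage (fun w : ℂ => w ^ l) 0 1 = if l = 0 then 1 else 0 := by
  split_ifs with h
  · subst h
    simp only [zpow_zero]
    exact circleAverage_const _ _ _
  · rw [circleAverage_eq_circleIntegral one_ne_zero]
    have h1 : (∮ z in C(0, 1), (z - 0)⁻¹ • z ^ l) = ∮ z in C(0, 1), (z - 0) ^ (l - 1) := by
      refine circleIntegral.integral_congr zero_le_one fun z hz => ?_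
      have hz0 : z ≠ 0 := by
        rintro rfl
        simp at hz
      simp only [sub_zero, smul_eq_mul]
      rw [zpow_sub_one₀ hz0, mul_comm]
    rw [h1, circleIntegral.integral_sub_zpow_of_ne (by omega), smul_zero]

theorem circleIntegrable_zpow (l : ℤ) : CircleIntegrable (fun w : ℂ => w ^ l) 0 1 := by
  refine ContinuousOn.circleIntegrable zero_le_one fun z hz => ?_
  have hz0 : z ≠ 0 := by
    rintro rfl
    simp at hz
  exact (continuousAt_zpow₀ z l (Or.inl hz0)).continuousWithinAt

theorem circleAverage_pow_mul {h : ℂ → ℂ} (hh : ∀ w : ℂ, ‖w‖ ≤ 1 → DifferentiableAt ℂ h w) {d : ℕ}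
    (hd : d ≠ 0) : circleAverage (fun w => w ^ d * h w) 0 1 = 0 := by
  have h1 : ∀ w : ℂ, ‖w‖ ≤ 1 → DifferentiableAt ℂ (fun w => w ^ d * h w) w := fun w hw =>
    ((differentiableAt_id).pow d).mul (hh w hw)
  rw [circleAverage_of_differentiable_on_off_countable Set.countable_empty]
  · simp [hd]
  · intro w hw
    refine (h1 w ?_).continuousAt.continuousWithinAt
    simpa using hw
  · intro w hw
    refine h1 w ?_
    have := hw.1
    simp at this
    exact this.le

/-- The mean over the unit circle of a function whose `k`-th block is a polynomial plus a
holomorphic remainder of high order. -/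
theorem circleAverage_sum_zpow (T : ℕ) (a : ℕ → ℕ → ℂ) (h : ℕ → ℂ → ℂ)
    (hh : ∀ k, ∀ w : ℂ, ‖w‖ ≤ 1 → DifferentiableAt ℂ (h k) w) :
    CircleIntegrable (fun w : ℂ => ∑ k ∈ Finset.range T,
      ((∑ j ∈ Finset.range T, a k j * w ^ ((j : ℤ) - k)) + w ^ (T - k) * h k w)) 0 1 ∧
    circleAverage (fun w : ℂ => ∑ k ∈ Finset.range T,
      ((∑ j ∈ Finset.range T, a k j * w ^ ((j : ℤ) - k)) + w ^ (T - k) * h k w)) 0 1 =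
      ∑ k ∈ Finset.range T, a k k := by
  have hi1 : ∀ k j, CircleIntegrable (fun w : ℂ => a k j * w ^ ((j : ℤ) - k)) 0 1 := fun k j =>
    (circleIntegrable_zpow _).const_fun_smul (a := a k j)
  have hi2 : ∀ k, CircleIntegrable (fun w : ℂ => w ^ (T - k) * h k w) 0 1 := fun k => by
    refine ContinuousOn.circleIntegrable zero_le_one fun w hw => ?_
    have hw1 : ‖w‖ ≤ 1 := by simp at hw; exact hw.le
    exact (((continuous_pow (T - k)).continuousAt).mul (hh k w hw1).continuousAt).continuousWithinAt
  have hi3 : ∀ k, CircleIntegrable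
      (fun w : ℂ => ∑ j ∈ Finset.range T, a k j * w ^ ((j : ℤ) - k)) 0 1 := fun k =>
    CircleIntegrable.fun_sum _ fun j _ => hi1 k j
  have hi4 : ∀ k, CircleIntegrable (fun w : ℂ =>
      (∑ j ∈ Finset.range T, a k j * w ^ ((j : ℤ) - k)) + w ^ (T - k) * h k w) 0 1 := fun k =>
    (hi3 k).add (hi2 k)
  refine ⟨CircleIntegrable.fun_sum _ fun k _ => hi4 k, ?_⟩
  rw [circleAverage_fun_sum fun k _ => hi4 k]
  refine Finset.sum_congr rfl fun k hk => ?_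
  have hk' := Finset.mem_range.mp hk
  -- As k < T, the exponent T - k is positive and the holomorphic remainder averages to its value 0
  -- at the centre.
  rw [circleAverage_fun_add (hi3 k) (hi2 k), circleAverage_pow_mul (hh k) (by omega), add_zero,
    circleAverage_fun_sum fun j _ => hi1 k j, Finset.sum_eq_single k]
  · have := circleAverage_fun_smul (a := a k k) (f := fun w : ℂ => w ^ ((k : ℤ) - k)) (c := 0)
      (R := 1)
    simp only [smul_eq_mul] at this
    rw [this, circleAverage_zpow]
    simp
  · intro j _ hjk
    have := circleAverage_fun_smul (a := a k j) (f := fun w : ℂ => w ^ ((j : ℤ) - k)) (c := 0)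
      (R := 1)
    simp only [smul_eq_mul] at this
    rw [this, circleAverage_zpow, if_neg (by omega), mul_zero]
  · intro h; exact absurd hk h

theorem circleAverage_re_nonneg {F : ℂ → ℂ} (hF : CircleIntegrable F 0 1) {S : Set ℂ}
    (hS : S.Finite) (h : ∀ w : ℂ, ‖w‖ = 1 → w ∉ S → 0 ≤ (F w).re) :
    0 ≤ (circleAverage F 0 1).re := by
  classical
  have h1 := Complex.reCLM.circleAverage_comp_comm hF
  rw [← Complex.reCLM_apply, ← h1]
  have h2 : circleAverage (Complex.reCLM ∘ F) 0 1 =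
      circleAverage (fun w => if w ∈ S then 0 else (F w).re) 0 1 := by
    refine circleAverage_congr_codiscreteWithin ?_ one_ne_zero
    have hm : Sᶜ ∈ Filter.codiscreteWithin (Metric.sphere (0 : ℂ) |1|) := by
      rw [codiscreteWithin_iff_locallyFiniteComplementWithin]
      intro z _
      refine ⟨Set.univ, Filter.univ_mem, hS.subset ?_⟩
      rintro w ⟨-, -, hw⟩
      simpa using hw
    filter_upwards [hm] with w hw
    rw [if_neg hw]; rfl
  rw [h2]
  refine circleAverage_nonneg_of_nonneg fun w hw => ?_
  split_ifs with hwS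
  · exact le_rfl
  · exact h w (by simpa using hw) hwS

end CircleAverages

/-! ### Holomorphy of matrix inverses -/

section ResolventDifferentiable

variable {n : ℕ}

theorem differentiableAt_matrix_det {M : ℂ → Matrix (Fin n) (Fin n) ℂ} {w : ℂ}
    (h : ∀ i j, DifferentiableAt ℂ (fun w => M w i j) w) :
    DifferentiableAt ℂ (fun w => (M w).det) w := by
  simp only [Matrix.det_apply]
  refine DifferentiableAt.fun_sum fun σ _ => ?_
  refine DifferentiableAt.const_smul ?_ _
  exact DifferentiableAt.fun_finsetProd fun i _ => h _ _

theorem differentiableAt_matrix_inv {M : ℂ → Matrix (Fin n) (Fin n) ℂ} {w : ℂ}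
    (h : ∀ i j, DifferentiableAt ℂ (fun w => M w i j) w) (hw : (M w).det ≠ 0) (i j : Fin n) :
    DifferentiableAt ℂ (fun w => (M w)⁻¹ i j) w := by
  simp only [Matrix.inv_def, Matrix.smul_apply, Ring.inverse_eq_inv', smul_eq_mul,
    Matrix.adjugate_apply]
  refine ((differentiableAt_matrix_det h).inv hw).mul (differentiableAt_matrix_det fun k l => ?_)
  simp only [Matrix.updateRow_apply]
  split_ifs
  · exact differentiableAt_const _
  · exact h k l

end ResolventDifferentiable

/-! ### Positive realness implies passivity -/

section Passivity

variable {m n : ℕ} (A : Matrix (Fin n) (Fin n) ℝ) (B : Matrix (Fin n) (Fin m) ℝ)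
  (C : Matrix (Fin m) (Fin n) ℝ) (J : Matrix (Fin m) (Fin m) ℝ)

/-- The state trajectory of `x ↦ A x + B u`. -/
def stateTrajectory (u : ℕ → Fin m → ℝ) (x : Fin n → ℝ) : ℕ → Fin n → ℝ
  | 0 => x
  | k + 1 => A *ᵥ stateTrajectory u x k + B *ᵥ u k

theorem stateTrajectory_succ' (u : ℕ → Fin m → ℝ) (x : Fin n → ℝ) (k : ℕ) :
    stateTrajectory A B u x (k + 1) =
      stateTrajectory A B (fun k => u (k + 1)) (A *ᵥ x + B *ᵥ u 0) k := by
  induction k with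
  | zero => rfl
  | succ k ih => rw [stateTrajectory, ih, stateTrajectory]

theorem suppliedEnergy_eq_sum (T : ℕ) (u : ℕ → Fin m → ℝ) (x : Fin n → ℝ) :
    suppliedEnergy A B C J T u x =
      ∑ k ∈ Finset.range T, u k ⬝ᵥ (C *ᵥ stateTrajectory A B u x k + J *ᵥ u k) := by
  induction T generalizing u x with
  | zero => rfl
  | succ T ih =>
    rw [suppliedEnergy, ih, Finset.sum_range_succ', add_comm]
    simp only [stateTrajectory_succ' A B u x]
    rfl

/-- A real vector regarded as a complex vector. -/
def complexify {ι : Type*} (v : ι → ℝ) : ι → ℂ := fun i => v i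

theorem map_mulVec_complexify {ι κ : Type*} [Fintype κ] (M : Matrix ι κ ℝ) (q : κ → ℝ) :
    M.map (algebraMap ℝ ℂ) *ᵥ complexify q = complexify (M *ᵥ q) := map_mulVec_ofReal M q

theorem complexify_add {ι : Type*} (v w : ι → ℝ) :
    complexify (v + w) = complexify v + complexify w := by
  ext i; simp [complexify]

theorem complexify_dotProduct {ι : Type*} [Fintype ι] (v w : ι → ℝ) :
    complexify v ⬝ᵥ complexify w = ((v ⬝ᵥ w : ℝ) : ℂ) := by
  simp [complexify, dotProduct]

variable {A B C J}

theorem mulVec_sum_smul {ι κ : Type*} [Fintype κ] (M : Matrix ι κ ℂ) (T : ℕ) (c : ℕ → ℂ)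
    (v : ℕ → κ → ℂ) :
    M *ᵥ (∑ k ∈ Finset.range T, c k • v k) = ∑ k ∈ Finset.range T, c k • (M *ᵥ v k) := by
  rw [← Matrix.mulVecLin_apply, map_sum]
  simp

/-- The `z`-transform of a trajectory starting at rest and truncated at time `T`. -/
theorem resolvent_mulVec_transform (u : ℕ → Fin m → ℝ) (T : ℕ) (w : ℂ) (e : Fin n → ℂ)
    (he : (1 - w • A.map (algebraMap ℝ ℂ)) *ᵥ e = complexify (stateTrajectory A B u 0 T)) :
    (1 - w • A.map (algebraMap ℝ ℂ)) *ᵥ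
        ((∑ k ∈ Finset.range T, w ^ k • complexify (stateTrajectory A B u 0 k)) + w ^ T • e) =
      w • (B.map (algebraMap ℝ ℂ) *ᵥ ∑ k ∈ Finset.range T, w ^ k • complexify (u k)) := by
  rw [Matrix.mulVec_add, Matrix.mulVec_smul, he, Matrix.sub_mulVec, Matrix.one_mulVec,
    Matrix.smul_mulVec, mulVec_sum_smul, mulVec_sum_smul, sub_add_eq_add_sub,
    ← Finset.sum_range_succ (fun k => w ^ k • complexify (stateTrajectory A B u 0 k)),
    Finset.sum_range_succ']
  have h0 : complexify (stateTrajectory A B u 0 0) = 0 := by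
    ext i; simp [complexify, stateTrajectory]
  rw [h0, smul_zero, add_zero, sub_eq_iff_eq_add, ← smul_add, ← Finset.sum_add_distrib,
    Finset.smul_sum]
  refine Finset.sum_congr rfl fun k _ => ?_
  rw [stateTrajectory, complexify_add, map_mulVec_complexify, map_mulVec_complexify, pow_succ',
    mul_smul, smul_add, smul_add, smul_add, add_comm]

/-- A stable system whose transfer function has nonnegative real part on the unit circle, up to
finitely many points, can only absorb energy from its rest state. -/
theorem suppliedEnergy_nonneg_of_positive_real
    (hstab : ∀ w : ℂ, ‖w‖ ≤ 1 →
      (1 - w • A.map (algebraMap ℝ ℂ) : Matrix (Fin n) (Fin n) ℂ).det ≠ 0)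
    {S : Set ℂ} (hS : S.Finite)
    (hpr : ∀ w : ℂ, ‖w‖ = 1 → w ∉ S → ∀ (v : Fin m → ℂ) (p : Fin n → ℂ),
      (1 - w • A.map (algebraMap ℝ ℂ)) *ᵥ p = w • (B.map (algebraMap ℝ ℂ) *ᵥ v) →
      0 ≤ (star v ⬝ᵥ (C.map (algebraMap ℝ ℂ) *ᵥ p + J.map (algebraMap ℝ ℂ) *ᵥ v)).re)
    (T : ℕ) (u : ℕ → Fin m → ℝ) : 0 ≤ suppliedEnergy A B C J T u 0 := by
  set x := stateTrajectory A B u 0 with hx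
  let y : ℕ → Fin m → ℝ := fun k => C *ᵥ x k + J *ᵥ u k
  -- The transform of the free response after time T, when the input is switched off; h below is its
  -- pairing with the inputs.
  let e : ℂ → Fin n → ℂ := fun w => (1 - w • A.map (algebraMap ℝ ℂ))⁻¹ *ᵥ complexify (x T)
  let a : ℕ → ℕ → ℂ := fun k j => ((u k ⬝ᵥ y j : ℝ) : ℂ)
  let h : ℕ → ℂ → ℂ := fun k w => complexify (u k) ⬝ᵥ (C.map (algebraMap ℝ ℂ) *ᵥ e w)
  have hh : ∀ k, ∀ w : ℂ, ‖w‖ ≤ 1 → DifferentiableAt ℂ (h k) w := by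
    intro k w hw
    have hM : ∀ i j, DifferentiableAt ℂ
        (fun w : ℂ => (1 - w • A.map (algebraMap ℝ ℂ))⁻¹ i j) w := by
      refine differentiableAt_matrix_inv (fun i j => ?_) (hstab w hw)
      simp only [Matrix.sub_apply, Matrix.smul_apply, smul_eq_mul]
      fun_prop
    simp only [h, e, dotProduct, Matrix.mulVec]
    refine DifferentiableAt.fun_sum fun i _ => (differentiableAt_const _).mul ?_
    refine DifferentiableAt.fun_sum fun j _ => (differentiableAt_const _).mul ?_
    exact DifferentiableAt.fun_sum fun l _ => (hM j l).mul (differentiableAt_const _)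
  obtain ⟨hint, havg⟩ := circleAverage_sum_zpow T a h hh
  have hre := circleAverage_re_nonneg hint hS (fun w hw hwS => ?_)
  · rw [havg] at hre
    rw [suppliedEnergy_eq_sum]
    rw [← Complex.ofReal_sum, Complex.ofReal_re] at hre
    exact hre
  · have hw0 : w ≠ 0 := by
      rintro rfl
      simp at hw
    set U : Fin m → ℂ := ∑ k ∈ Finset.range T, w ^ k • complexify (u k) with hU
    have he : (1 - w • A.map (algebraMap ℝ ℂ)) *ᵥ e w = complexify (x T) := by
      simp only [e]
      rw [Matrix.mulVec_mulVec, Matrix.mul_nonsing_inv _ (isUnit_iff_ne_zero.mpr (hstab w hw.le)),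
        Matrix.one_mulVec]
    have h1 := hpr w hw hwS U _ (resolvent_mulVec_transform u T w (e w) he)
    have h2 : C.map (algebraMap ℝ ℂ) *ᵥ
        ((∑ k ∈ Finset.range T, w ^ k • complexify (x k)) + w ^ T • e w) +
          J.map (algebraMap ℝ ℂ) *ᵥ U =
        (∑ j ∈ Finset.range T, w ^ j • complexify (y j)) +
          w ^ T • (C.map (algebraMap ℝ ℂ) *ᵥ e w) := by
      rw [Matrix.mulVec_add, Matrix.mulVec_smul, hU, mulVec_sum_smul, mulVec_sum_smul,
        add_right_comm, ← Finset.sum_add_distrib]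
      congr 1
      refine Finset.sum_congr rfl fun j _ => ?_
      rw [map_mulVec_complexify, map_mulVec_complexify, ← smul_add, ← complexify_add]
    -- On |w| = 1 conjugation inverts w, so star U pairs u k with w^(-k) and the constant term of
    -- the product is the supplied energy.
    have hstar : star U = ∑ k ∈ Finset.range T, (w⁻¹) ^ k • complexify (u k) := by
      rw [hU, star_sum]
      refine Finset.sum_congr rfl fun k _ => ?_
      ext i
      simp only [Pi.star_apply, Pi.smul_apply, smul_eq_mul, complexify, star_mul', star_pow]
      rw [Complex.star_def, Complex.conj_ofReal, ← Complex.inv_eq_conj hw]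
    rw [h2, hstar] at h1
    refine h1.trans_eq (congrArg Complex.re ?_)
    rw [sum_dotProduct]
    refine Finset.sum_congr rfl fun k hk => ?_
    have hkT : k ≤ T := (Finset.mem_range.mp hk).le
    rw [smul_dotProduct, dotProduct_add, dotProduct_sum, dotProduct_smul, smul_add,
      Finset.smul_sum]
    congr 1
    · refine Finset.sum_congr rfl fun j _ => ?_
      rw [dotProduct_smul, complexify_dotProduct, smul_eq_mul, smul_eq_mul, zpow_sub₀ hw0,
        zpow_natCast, zpow_natCast, inv_pow]
      simp only [a]
      field_simp
    · simp only [h, smul_eq_mul]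
      rw [← mul_assoc, inv_pow, pow_sub₀ _ hw0 hkT, mul_comm (w ^ T)]

end Passivity

/-! ### Necessity: from negative imaginary to passive -/

section Necessity

open Filter Topology

variable {m n : ℕ} {G : Matrix (Fin m) (Fin m) (RatFunc ℝ)}
  {A : Matrix (Fin n) (Fin n) ℝ} {B : Matrix (Fin n) (Fin m) ℝ}
  {C : Matrix (Fin m) (Fin n) ℝ} {D : Matrix (Fin m) (Fin m) ℝ}

theorem dotProduct_smul_sub_conjTranspose (M : Matrix (Fin m) (Fin m) ℂ) (v : Fin m → ℂ) :
    star v ⬝ᵥ ((Complex.I • (M - Mᴴ)) *ᵥ v) =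
      ((-2 * (star v ⬝ᵥ (M *ᵥ v)).im : ℝ) : ℂ) := by
  have h : star v ⬝ᵥ (Mᴴ *ᵥ v) = star (star v ⬝ᵥ (M *ᵥ v)) := by
    rw [← Matrix.star_dotProduct, Matrix.star_mulVec, ← Matrix.dotProduct_mulVec]
  rw [Matrix.smul_mulVec, Matrix.sub_mulVec, dotProduct_smul, dotProduct_sub, h, smul_eq_mul]
  apply Complex.ext
  · simp; ring
  · simp

theorem IsDiscreteNegImag.im_mul_im_nonpos {F : ℂ → Matrix (Fin m) (Fin m) ℂ}
    (hF : IsDiscreteNegImag F) {z : ℂ} (hz : 1 < ‖z‖) (v : Fin m → ℂ) :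
    z.im * (star v ⬝ᵥ (F z *ᵥ v)).im ≤ 0 := by
  rcases lt_trichotomy z.im 0 with h | h | h
  · have h1 := (hF.lower z hz h).dotProduct_mulVec_nonneg v
    rw [Matrix.neg_mulVec, dotProduct_neg, dotProduct_smul_sub_conjTranspose, ← Complex.ofReal_neg,
      Complex.zero_le_real] at h1
    nlinarith
  · simp [h]
  · have h1 := (hF.upper z hz h).dotProduct_mulVec_nonneg v
    rw [dotProduct_smul_sub_conjTranspose, Complex.zero_le_real] at h1
    nlinarith

theorem IsDiscreteNegImag.im_eq_zero {F : ℂ → Matrix (Fin m) (Fin m) ℂ}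
    (hF : IsDiscreteNegImag F) {z : ℂ} (hz : 1 < ‖z‖) (h : z.im = 0) (v : Fin m → ℂ) :
    (star v ⬝ᵥ (F z *ᵥ v)).im = 0 := by
  have h1 := dotProduct_smul_sub_conjTranspose (F z) v
  rw [hF.real_axis z hz h, Matrix.zero_mulVec, dotProduct_zero] at h1
  have h2 := congrArg Complex.re h1
  simp only [Complex.zero_re, Complex.ofReal_re] at h2
  linarith

theorem det_one_sub_smul_ne_zero {A' : Matrix (Fin n) (Fin n) ℂ}
    (h : ∀ z : ℂ, 1 < ‖z‖ → (z • (1 : Matrix (Fin n) (Fin n) ℂ) - A').det ≠ 0) {w : ℂ}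
    (hw : ‖w‖ < 1) : (1 - w • A').det ≠ 0 := by
  rcases eq_or_ne w 0 with rfl | hw0
  · simp
  · have h1 : 1 - w • A' = w • (w⁻¹ • (1 : Matrix (Fin n) (Fin n) ℂ) - A') := by
      rw [smul_sub, smul_smul, mul_inv_cancel₀ hw0, one_smul]
    rw [h1, Matrix.det_smul]
    refine mul_ne_zero (pow_ne_zero _ hw0) (h _ ?_)
    rw [norm_inv]
    exact (one_lt_inv₀ (norm_pos_iff.mpr hw0)).mpr hw

theorem IsMinimalRealization.transferEval_inv_eq (h : IsMinimalRealization G A B C D)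
    (hF : IsDiscreteNegImag (transferEval G)) {w : ℂ} (hw0 : w ≠ 0) (hw : ‖w‖ < 1) :
    transferEval G w⁻¹ = w • (C.map (algebraMap ℝ ℂ) * (1 - w • A.map (algebraMap ℝ ℂ))⁻¹ *
      B.map (algebraMap ℝ ℂ)) + D.map (algebraMap ℝ ℂ) := by
  have hz : 1 < ‖w⁻¹‖ := by
    rw [norm_inv]
    exact (one_lt_inv₀ (norm_pos_iff.mpr hw0)).mpr hw
  have hdet := h.det_resolvent_ne_zero fun i j => (hF.analytic i j _ hz).continuousAt
  rw [h.1.transferEval_eq hdet]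
  have h1 : w⁻¹ • (1 : Matrix (Fin n) (Fin n) ℂ) - A.map (algebraMap ℝ ℂ) =
      w⁻¹ • (1 - w • A.map (algebraMap ℝ ℂ)) := by
    rw [smul_sub, smul_smul, inv_mul_cancel₀ hw0, one_smul]
  have h2 : (w⁻¹ • (1 - w • A.map (algebraMap ℝ ℂ)))⁻¹ =
      w • (1 - w • A.map (algebraMap ℝ ℂ))⁻¹ := by
    apply Matrix.inv_eq_left_inv
    rw [Matrix.smul_mul, Matrix.mul_smul, smul_smul, mul_inv_cancel₀ hw0, one_smul]
    apply Matrix.nonsing_inv_mul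
    rw [h1, Matrix.det_smul] at hdet
    exact isUnit_iff_ne_zero.mpr (right_ne_zero_of_mul hdet)
  rw [h1, h2, Matrix.mul_smul, Matrix.smul_mul]

/-- D is the value at infinity, w = 1/z = 0. For real w in (0,1) the value is Hermitian, and this
survives w → 0⁺. -/
theorem IsMinimalRealization.feedthrough_symm (h : IsMinimalRealization G A B C D)
    (hF : IsDiscreteNegImag (transferEval G)) : D = Dᵀ := by
  set f : ℂ → Matrix (Fin m) (Fin m) ℂ := fun w =>
    w • (C.map (algebraMap ℝ ℂ) * (1 - w • A.map (algebraMap ℝ ℂ))⁻¹ *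
      B.map (algebraMap ℝ ℂ)) + D.map (algebraMap ℝ ℂ) with hf
  have hinv : ContinuousAt (fun w : ℂ => (1 - w • A.map (algebraMap ℝ ℂ))⁻¹) 0 := by
    have h1 : ContinuousAt (fun w : ℂ => 1 - w • A.map (algebraMap ℝ ℂ)) 0 := by fun_prop
    refine ContinuousAt.comp (g := Inv.inv) (continuousAt_matrix_inv _ ?_) h1
    rw [Ring.inverse_eq_inv']
    exact continuousAt_inv₀ (by simp)
  have hcont : ContinuousAt f 0 := by
    have h2 : Continuous fun M : Matrix (Fin n) (Fin n) ℂ =>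
        C.map (algebraMap ℝ ℂ) * M * B.map (algebraMap ℝ ℂ) := by fun_prop
    exact (continuousAt_id.smul (h2.continuousAt.comp hinv)).add continuousAt_const
  have hsym : ∀ w : ℝ, 0 < w → w < 1 → (f w)ᴴ = f w := by
    intro w h0 h1
    have hn : ‖(w : ℂ)‖ < 1 := by rwa [Complex.norm_real, Real.norm_of_nonneg h0.le]
    have hw0 : (w : ℂ) ≠ 0 := by exact_mod_cast h0.ne'
    rw [hf]
    simp only
    rw [← h.transferEval_inv_eq hF hw0 hn]
    have hz : 1 < ‖(w : ℂ)⁻¹‖ := by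
      rw [norm_inv]
      exact (one_lt_inv₀ (norm_pos_iff.mpr hw0)).mpr hn
    have h3 := hF.real_axis (w : ℂ)⁻¹ hz (by rw [← Complex.ofReal_inv, Complex.ofReal_im])
    rw [smul_eq_zero, sub_eq_zero] at h3
    exact (h3.resolve_left Complex.I_ne_zero).symm
  have hlim : Tendsto (fun w : ℝ => f w) (𝓝[>] 0) (𝓝 (f 0)) := by
    have h4 : Tendsto (fun w : ℝ => (w : ℂ)) (𝓝[>] 0) (𝓝 0) := by
      have := Complex.continuous_ofReal.tendsto 0
      rw [Complex.ofReal_zero] at this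
      exact this.mono_left nhdsWithin_le_nhds
    exact hcont.tendsto.comp h4
  have hlim2 : Tendsto (fun w : ℝ => (f w)ᴴ) (𝓝[>] 0) (𝓝 (f 0)ᴴ) :=
    (continuous_id.matrix_conjTranspose.tendsto _).comp hlim
  have heq : (f 0)ᴴ = f 0 := by
    refine tendsto_nhds_unique hlim2 (hlim.congr' ?_)
    filter_upwards [Ioo_mem_nhdsGT (zero_lt_one' ℝ)] with w hw
    exact (hsym w hw.1 hw.2).symm
  have hf0 : f 0 = D.map (algebraMap ℝ ℂ) := by simp [hf]
  rw [hf0] at heq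
  ext i j
  have h5 := congrFun (congrFun heq j) i
  simp only [Matrix.conjTranspose_apply, Matrix.map_apply, Complex.coe_algebraMap,
    Complex.star_def, Complex.conj_ofReal, Complex.ofReal_inj] at h5
  exact h5

/-- On the unit circle (ζ+1)/(ζ-1) = -2i Im ζ / |ζ-1|², so only the imaginary part of g₁ - g₂
contributes. -/
theorem re_cayley_mul {ζ g₁ g₂ : ℂ} (hζ : ‖ζ‖ = 1) (hζ1 : ζ ≠ 1) (hg : g₁.im = 0) :
    ((ζ + 1) / (ζ - 1) * (g₁ - g₂)).re = -(2 / Complex.normSq (ζ - 1)) * (ζ.im * g₂.im) := by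
  have h1 : Complex.normSq (ζ - 1) ≠ 0 := by
    rw [Ne, Complex.normSq_eq_zero, sub_eq_zero]; exact hζ1
  have h2 : ζ.re * ζ.re + ζ.im * ζ.im = 1 := by
    rw [← Complex.normSq_apply, Complex.normSq_eq_norm_sq, hζ, one_pow]
  have h3 : (ζ + 1) / (ζ - 1) = ((-2 * ζ.im / Complex.normSq (ζ - 1) : ℝ) : ℂ) * Complex.I := by
    apply Complex.ext
    · rw [Complex.div_re, ← add_div, Complex.re_ofReal_mul, Complex.I_re, mul_zero,
        div_eq_zero_iff]
      left
      simp only [Complex.add_re, Complex.sub_re, Complex.one_re, Complex.add_im, Complex.sub_im,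
        Complex.one_im]
      linarith
    · rw [Complex.div_im, ← sub_div, Complex.im_ofReal_mul, Complex.I_im, mul_one]
      congr 1
      simp only [Complex.add_re, Complex.sub_re, Complex.one_re, Complex.add_im, Complex.sub_im,
        Complex.one_im]
      ring
  rw [h3, mul_assoc, Complex.re_ofReal_mul, Complex.I_mul_re, Complex.sub_im, hg]
  ring

/-- The Cayley-type transform of a negative imaginary function evaluated on a circle of radius
`t⁻¹ > 1` is positive real. -/
theorem IsMinimalRealization.positive_real_of_negImag (h : IsMinimalRealization G A B C D)
    (hF : IsDiscreteNegImag (transferEval G)) {t : ℝ} (ht0 : 0 < t) (ht1 : t < 1)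
    {w : ℂ} (hw : ‖w‖ = 1) (hw1 : w ≠ 1) {v : Fin m → ℂ} {p s : Fin n → ℂ}
    (hs : (1 - (t : ℂ) • A.map (algebraMap ℝ ℂ)) *ᵥ s = (t : ℂ) • (B.map (algebraMap ℝ ℂ) *ᵥ v))
    (hp : (1 - (w * t) • A.map (algebraMap ℝ ℂ)) *ᵥ p =
      w • ((1 + (t : ℂ) • A.map (algebraMap ℝ ℂ)) *ᵥ s)) :
    0 ≤ (star v ⬝ᵥ (C.map (algebraMap ℝ ℂ) *ᵥ (p + s))).re := by
  set A' := A.map (algebraMap ℝ ℂ) with hA'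
  have hdet : ∀ w : ℂ, ‖w‖ < 1 → (1 - w • A').det ≠ 0 := fun w hw =>
    det_one_sub_smul_ne_zero (fun z hz => h.det_resolvent_ne_zero fun i j =>
      (hF.analytic i j _ hz).continuousAt) hw
  have hw0 : w ≠ 0 := by
    rintro rfl
    simp at hw
  have ht0' : (t : ℂ) ≠ 0 := by exact_mod_cast ht0.ne'
  have hnt : ‖(t : ℂ)‖ < 1 := by rwa [Complex.norm_real, Real.norm_of_nonneg ht0.le]
  have hnwt : ‖w * t‖ < 1 := by rwa [norm_mul, hw, one_mul]
  have hGs : ∀ (c : ℂ) (e : Fin n → ℂ), c ≠ 0 → ‖c‖ < 1 →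
      (1 - c • A') *ᵥ e = c • (B.map (algebraMap ℝ ℂ) *ᵥ v) →
      transferEval G c⁻¹ *ᵥ v = C.map (algebraMap ℝ ℂ) *ᵥ e + D.map (algebraMap ℝ ℂ) *ᵥ v := by
    intro c e hc0 hc he
    rw [h.transferEval_inv_eq hF hc0 hc, Matrix.add_mulVec, Matrix.smul_mulVec,
      ← Matrix.mulVec_mulVec, ← Matrix.mulVec_mulVec, ← Matrix.mulVec_smul, ← Matrix.mulVec_smul,
      ← he, Matrix.mulVec_mulVec e, Matrix.nonsing_inv_mul _ (isUnit_iff_ne_zero.mpr (hdet c hc)),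
      Matrix.one_mulVec]
  have hζ1 : w⁻¹ ≠ 1 := fun h1 => hw1 (inv_eq_one.mp h1)
  have hζ1' : w⁻¹ - 1 ≠ 0 := sub_ne_zero.mpr hζ1
  obtain ⟨q, hq⟩ : ∃ q, (1 - (w * t) • A') *ᵥ q = (w * t) • (B.map (algebraMap ℝ ℂ) *ᵥ v) :=
    ⟨(1 - (w * t) • A')⁻¹ *ᵥ ((w * t) • (B.map (algebraMap ℝ ℂ) *ᵥ v)), by
      rw [Matrix.mulVec_mulVec, Matrix.mul_nonsing_inv _ (isUnit_iff_ne_zero.mpr (hdet _ hnwt)),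
        Matrix.one_mulVec]⟩
  -- Resolvent identity: p + s = (1+w)(1-wtA)⁻¹s and s - q = (1-w)(1-wtA)⁻¹s. Here s and q are the
  -- states for G at 1/t and at 1/(wt).
  have hps : p + s = ((w⁻¹ + 1) / (w⁻¹ - 1)) • (s - q) := by
    have h1 : (w⁻¹ - 1) • (p + s) = (w⁻¹ + 1) • (s - q) := by
      rw [← sub_eq_zero]
      refine Matrix.eq_zero_of_mulVec_eq_zero (hdet _ hnwt) ?_
      have hq' : (1 - (w * t) • A') *ᵥ q = w • ((1 - (t : ℂ) • A') *ᵥ s) := by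
        rw [hq, hs, mul_smul]
      rw [Matrix.mulVec_sub, Matrix.mulVec_smul, Matrix.mulVec_smul, Matrix.mulVec_add,
        Matrix.mulVec_sub, hp, hq']
      simp only [Matrix.sub_mulVec, Matrix.add_mulVec, Matrix.one_mulVec, Matrix.smul_mulVec]
      match_scalars <;> field_simp <;> ring
    rw [div_eq_inv_mul, mul_smul, ← h1, smul_smul, inv_mul_cancel₀ hζ1', one_smul]
  have hg1 := hGs t s ht0' hnt hs
  have hg2 := hGs (w * t) q (mul_ne_zero hw0 ht0') hnwt hq
  have hval : star v ⬝ᵥ (C.map (algebraMap ℝ ℂ) *ᵥ (p + s)) = (w⁻¹ + 1) / (w⁻¹ - 1) *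
      (star v ⬝ᵥ (transferEval G (t : ℂ)⁻¹ *ᵥ v) - star v ⬝ᵥ (transferEval G (w * t)⁻¹ *ᵥ v)) := by
    rw [hg1, hg2, ← dotProduct_sub, add_sub_add_right_eq_sub, ← Matrix.mulVec_sub, hps,
      Matrix.mulVec_smul, dotProduct_smul, smul_eq_mul]
  have hz1 : 1 < ‖(t : ℂ)⁻¹‖ := by
    rw [norm_inv]
    exact (one_lt_inv₀ (norm_pos_iff.mpr ht0')).mpr hnt
  have hz2 : 1 < ‖(w * t)⁻¹‖ := by
    rw [norm_inv]
    exact (one_lt_inv₀ (norm_pos_iff.mpr (mul_ne_zero hw0 ht0'))).mpr hnwt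
  rw [hval, re_cayley_mul (by rw [norm_inv, hw, inv_one]) hζ1 (hF.im_eq_zero hz1 (by
    rw [← Complex.ofReal_inv, Complex.ofReal_im]) v)]
  have h2 := hF.im_mul_im_nonpos hz2 v
  have h3 : ((w * t)⁻¹).im = t⁻¹ * (w⁻¹).im := by
    rw [mul_inv, mul_comm, ← Complex.ofReal_inv, Complex.im_ofReal_mul]
  rw [h3, mul_assoc] at h2
  have h4 : (w⁻¹).im * (star v ⬝ᵥ (transferEval G (w * t)⁻¹ *ᵥ v)).im ≤ 0 := by
    have := inv_pos.mpr ht0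
    by_contra hcon
    push Not at hcon
    exact absurd h2 (not_le.mpr (mul_pos this hcon))
  have h5 : 0 ≤ 2 / Complex.normSq (w⁻¹ - 1) := div_nonneg zero_le_two (Complex.normSq_nonneg _)
  nlinarith

theorem continuous_suppliedEnergy (C : Matrix (Fin m) (Fin n) ℝ) (T : ℕ) (u : ℕ → Fin m → ℝ) :
    Continuous fun p : Matrix (Fin n) (Fin n) ℝ × Matrix (Fin n) (Fin m) ℝ ×
        Matrix (Fin m) (Fin m) ℝ × (Fin n → ℝ) =>
      suppliedEnergy p.1 p.2.1 C p.2.2.1 T u p.2.2.2 := by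
  induction T generalizing u with
  | zero => exact continuous_const
  | succ T ih =>
    simp only [suppliedEnergy]
    have hA : Continuous fun p : Matrix (Fin n) (Fin n) ℝ × Matrix (Fin n) (Fin m) ℝ ×
        Matrix (Fin m) (Fin m) ℝ × (Fin n → ℝ) => p.1 := continuous_fst
    have hB : Continuous fun p : Matrix (Fin n) (Fin n) ℝ × Matrix (Fin n) (Fin m) ℝ ×
        Matrix (Fin m) (Fin m) ℝ × (Fin n → ℝ) => p.2.1 := continuous_fst.comp continuous_snd
    have hJ : Continuous fun p : Matrix (Fin n) (Fin n) ℝ × Matrix (Fin n) (Fin m) ℝ ×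
        Matrix (Fin m) (Fin m) ℝ × (Fin n → ℝ) => p.2.2.1 :=
      continuous_fst.comp (continuous_snd.comp continuous_snd)
    have hx : Continuous fun p : Matrix (Fin n) (Fin n) ℝ × Matrix (Fin n) (Fin m) ℝ ×
        Matrix (Fin m) (Fin m) ℝ × (Fin n → ℝ) => p.2.2.2 :=
      continuous_snd.comp (continuous_snd.comp continuous_snd)
    refine Continuous.add ?_ ?_
    · exact continuous_const.dotProduct ((continuous_const.matrix_mulVec hx).add
        (hJ.matrix_mulVec continuous_const))
    · have h1 := (hA.matrix_mulVec hx).add (hB.matrix_mulVec (continuous_const (y := u 0)))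
      exact (ih fun k => u (k + 1)).comp (hA.prodMk (hB.prodMk (hJ.prodMk h1)))

theorem map_smul_ofReal {k l : ℕ} (t : ℝ) (M : Matrix (Fin k) (Fin l) ℝ) :
    (t • M).map (algebraMap ℝ ℂ) = (t : ℂ) • M.map (algebraMap ℝ ℂ) := by
  ext i j; simp

theorem map_one_ofReal {k : ℕ} :
    (1 : Matrix (Fin k) (Fin k) ℝ).map (algebraMap ℝ ℂ) = 1 :=
  Matrix.map_one _ (map_zero _) (map_one _)

/-- The pair (tA, tB) realizes G(z/t) and is strictly stable, so passivity applies; the single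
exceptional point is the pole w = 1 of the Cayley factor. -/
theorem IsMinimalRealization.suppliedEnergy_scaled_nonneg (h : IsMinimalRealization G A B C D)
    (hF : IsDiscreteNegImag (transferEval G)) {t : ℝ} (ht0 : 0 < t) (ht1 : t < 1)
    (T : ℕ) (u : ℕ → Fin m → ℝ) :
    0 ≤ suppliedEnergy (t • A) ((1 + t • A) * ((1 - t • A)⁻¹ * (t • B))) C
      (C * ((1 - t • A)⁻¹ * (t • B))) T u 0 := by
  have hdet : ∀ w : ℂ, ‖w‖ < 1 → (1 - w • A.map (algebraMap ℝ ℂ)).det ≠ 0 := fun w hw =>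
    det_one_sub_smul_ne_zero (fun z hz => h.det_resolvent_ne_zero fun i j =>
      (hF.analytic i j _ hz).continuousAt) hw
  have hnt : ‖(t : ℂ)‖ < 1 := by rwa [Complex.norm_real, Real.norm_of_nonneg ht0.le]
  have hdett : (1 - t • A).det ≠ 0 := by
    intro h0
    apply hdet t hnt
    have h1 : 1 - (t : ℂ) • A.map (algebraMap ℝ ℂ) =
        (algebraMap ℝ ℂ).mapMatrix (1 - t • A) := by
      rw [map_sub, map_one, RingHom.mapMatrix_apply, map_smul_ofReal]
    rw [h1, ← RingHom.map_det, h0, map_zero]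
  obtain ⟨N, hN⟩ : ∃ N, N = (1 - t • A)⁻¹ * (t • B) := ⟨_, rfl⟩
  rw [← hN]
  have hNB : (1 - t • A) * N = t • B := by
    rw [hN, ← Matrix.mul_assoc, Matrix.mul_nonsing_inv _ (isUnit_iff_ne_zero.mpr hdett),
      Matrix.one_mul]
  refine suppliedEnergy_nonneg_of_positive_real (fun w hw => ?_) (Set.finite_singleton 1) ?_ T u
  · rw [map_smul_ofReal, smul_smul]
    refine hdet _ ?_
    rw [norm_mul]
    calc ‖w‖ * ‖(t : ℂ)‖ ≤ 1 * ‖(t : ℂ)‖ := by gcongr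
      _ < 1 := by rwa [one_mul]
  · intro w hw hwS v p hp
    have hs : (1 - (t : ℂ) • A.map (algebraMap ℝ ℂ)) *ᵥ (N.map (algebraMap ℝ ℂ) *ᵥ v) =
        (t : ℂ) • (B.map (algebraMap ℝ ℂ) *ᵥ v) := by
      rw [← Matrix.smul_mulVec, ← map_smul_ofReal t B, ← hNB, Matrix.map_mul, ← Matrix.mulVec_mulVec,
        Matrix.map_sub _ (map_sub _), map_one_ofReal, map_smul_ofReal]
    have hp' : (1 - (w * t) • A.map (algebraMap ℝ ℂ)) *ᵥ p =
        w • ((1 + (t : ℂ) • A.map (algebraMap ℝ ℂ)) *ᵥ (N.map (algebraMap ℝ ℂ) *ᵥ v)) := by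
      rw [map_smul_ofReal, smul_smul, Matrix.map_mul, ← Matrix.mulVec_mulVec,
        Matrix.map_add _ (map_add _), map_one_ofReal, map_smul_ofReal] at hp
      exact hp
    have := h.positive_real_of_negImag hF ht0 ht1 hw (by simpa using hwS) hs hp'
    rwa [Matrix.mulVec_add, Matrix.mulVec_mulVec v, ← Matrix.map_mul] at this

/-- Let t → 1⁻: over a fixed finite horizon the energy is continuous in the system matrices, and
(1-tA)⁻¹ is continuous at t = 1 because 1 - A is invertible. -/
theorem IsMinimalRealization.suppliedEnergy_nonneg_of_negImag (h : IsMinimalRealization G A B C D)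
    (hminus : (1 - A).det ≠ 0) (hF : IsDiscreteNegImag (transferEval G)) (T : ℕ)
    (u : ℕ → Fin m → ℝ) :
    0 ≤ suppliedEnergy A ((1 + A) * ((1 - A)⁻¹ * B)) C (C * ((1 - A)⁻¹ * B)) T u 0 := by
  set f : ℝ → ℝ := fun t => suppliedEnergy (t • A) ((1 + t • A) * ((1 - t • A)⁻¹ * (t • B))) C
    (C * ((1 - t • A)⁻¹ * (t • B))) T u 0 with hf
  have hinv : ContinuousAt (fun t : ℝ => (1 - t • A)⁻¹) 1 := by
    have h1 : ContinuousAt (fun t : ℝ => 1 - t • A) 1 := by fun_prop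
    refine ContinuousAt.comp (g := Inv.inv) (continuousAt_matrix_inv _ ?_) h1
    rw [Ring.inverse_eq_inv', one_smul]
    exact continuousAt_inv₀ hminus
  have hcont : ContinuousAt f 1 := by
    have h2 : Continuous fun p : ℝ × Matrix (Fin n) (Fin n) ℝ =>
        suppliedEnergy (p.1 • A) ((1 + p.1 • A) * (p.2 * (p.1 • B))) C
          (C * (p.2 * (p.1 • B))) T u 0 :=
      (continuous_suppliedEnergy C T u).comp (Continuous.prodMk (by fun_prop)
        (Continuous.prodMk (by fun_prop) (Continuous.prodMk (by fun_prop) continuous_const)))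
    exact ContinuousAt.comp (f := fun t : ℝ => (t, (1 - t • A)⁻¹)) h2.continuousAt
      (continuousAt_id.prodMk hinv)
  have hf1 : f 1 = suppliedEnergy A ((1 + A) * ((1 - A)⁻¹ * B)) C (C * ((1 - A)⁻¹ * B)) T u 0 := by
    simp only [hf, one_smul]
  rw [← hf1]
  refine ge_of_tendsto (hcont.tendsto.mono_left (nhdsWithin_le_nhds (s := Set.Iio 1))) ?_
  filter_upwards [Ioo_mem_nhdsLT (zero_lt_one' ℝ)] with t ht
  exact h.suppliedEnergy_scaled_nonneg hF ht.1 ht.2 T u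

end Necessity

theorem mainTheorem3 {m n : ℕ} (G : Matrix (Fin m) (Fin m) (RatFunc ℝ))
    (A : Matrix (Fin n) (Fin n) ℝ) (B : Matrix (Fin n) (Fin m) ℝ)
    (C : Matrix (Fin m) (Fin n) ℝ) (D : Matrix (Fin m) (Fin m) ℝ)
    (hproper : IsProperTransfer G)
    (hmin : IsMinimalRealization G A B C D)
    (hplus : (1 + A).det ≠ 0) (hminus : (1 - A).det ≠ 0) :
    (IsDiscreteNegImag (transferEval G) → NegImagStateSpaceCondition A B C D) ∧
      (G = G.transpose →
        (IsDiscreteNegImag (transferEval G) ↔ NegImagStateSpaceCondition A B C D)) := by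
  have hnec : IsDiscreteNegImag (transferEval G) → NegImagStateSpaceCondition A B C D := fun hF =>
    hmin.stateSpaceCondition_of_suppliedEnergy_nonneg hplus hminus (hmin.feedthrough_symm hF)
      (hmin.suppliedEnergy_nonneg_of_negImag hminus hF)
  exact ⟨hnec, fun hG =>
    ⟨hnec, isDiscreteNegImag_of_stateSpaceCondition hmin.1 hG hminus⟩⟩
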